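/- Let $n\in\mathbb N$, and let $\mathcal T_n$ be the class of (negative) Bernstein functions of $n$ variables: the functions $\psi\in C^\infty((-\infty,0)^n)$ with $\psi\le 0$ all of whose first-order partial derivatives are absolutely monotone, i.e. nonnegative on $(-\infty,0)^n$ together with all their partial derivatives of all orders. For pairwise commuting bounded $C_0$-semigroups $T_1,\dots,T_n$ in a complex Banach space $X$ with generators $A_1,\dots,A_n$ (generators are said to commute if their semigroups do), put $A=(A_1,\dots,A_n)$ and $T(u)=T_1(u_1)\cdots T_n(u_n)$ for $u\in\mathbb R_+^n$; such a $T$ is called a bounded $n$-parameter $C_0$-semigroup. For $\psi\in\mathcal T_n$ the operator $\psi(A)$ is the generator of the semigroup $$g_t(A)x=\int_{\mathbb R_+^n}T(u)x\,d\nu_t(u)\qquad(x\in X,\ t\ge 0)$$ (Bochner integral), where $\nu_t$ is the unique finite positive measure on $\mathbb R_+^n$ with $\int_{\mathbb R_+^n} e^{s\cdot u}\,d\nu_t(u)=e^{t\psi(s)}$ for all $s\in(-\infty,0)^n$. A complex Banach space $X$ of complex-valued functions on $\mathbb R^n$ belongs to the class $\mathcal C$ if: (a) $X$ contains the space $\mathcal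 D(\mathbb R^n)$ of smooth compactly supported functions as a vector subspace; (b) if $x_k\in\mathcal D(\mathbb R^n)$ have supports in a common compact set and $x_k\to 0$ uniformly on $\mathbb R^n$, then $x_k\to 0$ in $X$; (c) if $x_k\to 0$ in $X$, then $x_{k_m}(0)\to 0$ for some subsequence; (d) for $x\in X$ and $u\in\mathbb R_+^n$ the translate $x_u(s)=x(u+s)$ lies in $X$, and the operators $T(u)x=x_u$ are bounded in $X$ and form a bounded $n$-parameter $C_0$-semigroup; $\partial_1,\dots,\partial_n$ denote the generators of $T_1,\dots,T_n$ for this translation semigroup. Let $\psi\in\mathcal T_n$. 1. If $\psi$ is bounded on $(-\infty,0)^n$, then for every $M\ge 1$ there is a constant $C(M)$, depending only on $\psi$ and $M$, such that for every complex Banach space $X$ and all pairwise commuting generators $A_1,\dots,A_n$ of $C_0$-semigroups in $X$ with $\|T_j(t)\|\le M$ ($t\ge 0$, $j=1,\dots,n$) the operator $\psi(A)$ is defined on all of $X$ and $\|\psi(A)x\|\le C(M)\|x\|$ for all $x\in X$. 2. Conversely, let $X$ be any space of the class $\mathcal C$. If the operator $\psi(\partial_1,\dots,\partial_n)$ is bounded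 (on its domain), then $\psi$ is bounded on $(-\infty,0)^n$. 3. The spaces $C_0(\mathbb R^n)$ (continuous functions vanishing at infinity) and $UCB(\mathbb R^n)$ (bounded uniformly continuous functions), with the sup-norm, belong to the class $\mathcal C$. -/

import Mathlib

open Filter Topology MeasureTheory
open scoped NNReal ContDiff ZeroAtInfty BoundedContinuousFunction

noncomputable section

namespace BochnerPhillips

/-! ### Negative Bernstein functions of several variables -/

/-- The open negative orthant `(-∞, 0)^n`. -/
def negOrthant (n : ℕ) : Set (Fin n → ℝ) := {s | ∀ j, s j < 0}

/-- The first order partial derivative `∂f/∂s_j`. -/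
def partialDeriv {n : ℕ} (j : Fin n) (f : (Fin n → ℝ) → ℝ) (s : Fin n → ℝ) : ℝ :=
  fderiv ℝ f s (Pi.single j 1)

/-- `f` is absolutely monotone on `(-∞, 0)^n`: it is smooth there, and `f` and all its partial
derivatives of all orders are nonnegative there (`k = 0` gives `f` itself; `v` lists the `k`
variables of differentiation). -/
structure IsAbsolutelyMonotone {n : ℕ} (f : (Fin n → ℝ) → ℝ) : Prop where
  smooth : ContDiffOn ℝ ∞ f (negOrthant n)
  nonneg : ∀ (k : ℕ) (v : Fin k → Fin n), ∀ s ∈ negOrthant n,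
    0 ≤ iteratedFDeriv ℝ k f s (fun i => Pi.single (v i) 1)

/-- The class `𝒯_n` of (negative) Bernstein functions of `n` variables. Only the values of `ψ` on
`(-∞, 0)^n` matter. -/
structure IsBernstein {n : ℕ} (ψ : (Fin n → ℝ) → ℝ) : Prop where
  smooth : ContDiffOn ℝ ∞ ψ (negOrthant n)
  nonpos : ∀ s ∈ negOrthant n, ψ s ≤ 0
  partials : ∀ j, IsAbsolutelyMonotone (partialDeriv j ψ)

/-- `ψ` is bounded on `(-∞, 0)^n`. -/
def BoundedOnNegOrthant {n : ℕ} (ψ : (Fin n → ℝ) → ℝ) : Prop :=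
  ∃ K : ℝ, ∀ s ∈ negOrthant n, |ψ s| ≤ K

/-- `ν` is a finite measure on `ℝ_+^n` whose Laplace transform is `g` on `(-∞, 0)^n`. -/
def HasLaplaceTransform {n : ℕ} (ν : FiniteMeasure (Fin n → ℝ≥0)) (g : (Fin n → ℝ) → ℝ) : Prop :=
  ∀ s ∈ negOrthant n,
    ∫ u : Fin n → ℝ≥0, Real.exp (∑ j, s j * (u j : ℝ)) ∂(ν : Measure (Fin n → ℝ≥0)) = g s

/-- The finite measure `ν_t` on `ℝ_+^n` with Laplace transform `exp (t ψ)` on `(-∞, 0)^n`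
(for `ψ` in `𝒯_n` there is exactly one). -/
def subMeasure {n : ℕ} (ψ : (Fin n → ℝ) → ℝ) (t : ℝ≥0) : FiniteMeasure (Fin n → ℝ≥0) :=
  Classical.epsilon fun ν => HasLaplaceTransform ν fun s => Real.exp ((t : ℝ) * ψ s)

/-! ### Semigroups and generators -/

section Semigroups

variable {X : Type*} [NormedAddCommGroup X] [NormedSpace ℂ X]

/-- One-parameter `C₀`-semigroups of bounded operators in `X`. -/
structure C0Semigroup (X : Type*) [NormedAddCommGroup X] [NormedSpace ℂ X] where
  op : ℝ≥0 → X →L[ℂ] X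
  op_zero : op 0 = 1
  op_add : ∀ s t, op (s + t) = op s * op t
  tendsto_zero : ∀ x, Tendsto (fun t => op t x) (𝓝 0) (𝓝 x)

/-- The domain of the generator of `S`: the `x` for which `lim_{t → 0+} t⁻¹ (S t x - x)` exists. -/
def generatorDomain (S : ℝ≥0 → X →L[ℂ] X) : Submodule ℂ X where
  carrier := {x | ∃ y, Tendsto (fun t : ℝ≥0 => (t : ℝ)⁻¹ • (S t x - x)) (𝓝[>] 0) (𝓝 y)}
  zero_mem' := ⟨0, by simp⟩
  add_mem' := by
    rintro a b ⟨y, hy⟩ ⟨z, hz⟩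
    refine ⟨y + z, (hy.add hz).congr fun t => ?_⟩
    rw [map_add, ← smul_add]
    congr 1
    abel
  smul_mem' := by
    rintro c a ⟨y, hy⟩
    refine ⟨c • y, (hy.const_smul c).congr fun t => ?_⟩
    rw [map_smul, ← smul_sub, smul_comm]

/-- The (infinitesimal) generator of a family `S t`, `t ≥ 0`, of bounded operators:
`x ↦ lim_{t → 0+} t⁻¹ (S t x - x)`, defined where this limit exists. -/
def generator (S : ℝ≥0 → X →L[ℂ] X) : X →ₗ.[ℂ] X where
  domain := generatorDomain S
  toFun :=
    { toFun := fun x => x.2.choose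
      map_add' := by
        intro a b
        refine tendsto_nhds_unique (a + b).2.choose_spec ?_
        refine (a.2.choose_spec.add b.2.choose_spec).congr fun t => ?_
        rw [Submodule.coe_add, map_add, ← smul_add]
        congr 1
        abel
      map_smul' := by
        intro c a
        refine tendsto_nhds_unique (c • a).2.choose_spec ?_
        refine (a.2.choose_spec.const_smul c).congr fun t => ?_
        rw [Submodule.coe_smul, map_smul, ← smul_sub, smul_comm] }

/-- Bounded `n`-parameter `C₀`-semigroups `T(u) = T_1(u_1) ⋯ T_n(u_n)`, given by pairwise commuting
bounded one-parameter `C₀`-semigroups `T_1, …, T_n`. The generators `A_1, …, A_n` of these form a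
tuple of commuting generators of bounded `C₀`-semigroups (commuting means that the semigroups
commute), and each such tuple arises from exactly one `T`. -/
structure MultiSemigroup (n : ℕ) (X : Type*) [NormedAddCommGroup X] [NormedSpace ℂ X] where
  part : Fin n → C0Semigroup X
  commute : ∀ i j s t, Commute ((part i).op s) ((part j).op t)
  bounded : ∀ j, ∃ M : ℝ, ∀ t, ‖(part j).op t‖ ≤ M

namespace MultiSemigroup

variable {n : ℕ} (T : MultiSemigroup n X)

/-- `T(u) = T_1(u_1) ⋯ T_n(u_n)`. -/
def op (u : Fin n → ℝ≥0) : X →L[ℂ] X := (List.ofFn fun j => (T.part j).op (u j)).prod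

theorem continuous_part (j : Fin n) : Continuous fun p : ℝ≥0 × X => (T.part j).op p.1 p.2 := by
  obtain ⟨M, hM⟩ := T.bounded j
  have hM0 : 0 ≤ M := (norm_nonneg _).trans (hM 0)
  rw [continuous_iff_continuousAt]
  rintro ⟨t, x⟩
  set S := (T.part j).op with hS
  -- For every `s`, `‖S s x - S t x‖ ≤ M * ‖S (s - t) x - x‖ + M * ‖S (t - s) x - x‖`.
  have key : ∀ s, ‖S s x - S t x‖ ≤ M * ‖S (s - t) x - x‖ + M * ‖S (t - s) x - x‖ := by
    intro s
    have aux : ∀ a b : ℝ≥0, a ≤ b → ‖S b x - S a x‖ ≤ M * ‖S (b - a) x - x‖ := by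
      intro a b hab
      have : S b x - S a x = S a (S (b - a) x - x) := by
        have h := (T.part j).op_add a (b - a)
        rw [add_tsub_cancel_of_le hab] at h
        rw [hS, h, map_sub]
        rfl
      rw [this]
      exact (S a).le_of_opNorm_le (hM a) _
    rcases le_total t s with h | h
    · exact (aux t s h).trans (le_add_of_nonneg_right (by positivity))
    · rw [norm_sub_rev]
      exact (aux s t h).trans (le_add_of_nonneg_left (by positivity))
  have hz : Tendsto (fun h : ℝ≥0 => ‖S h x - x‖) (𝓝 0) (𝓝 0) := by
    have := ((T.part j).tendsto_zero x).sub_const x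
    rw [sub_self] at this
    simpa using this.norm
  have h1 : Tendsto (fun p : ℝ≥0 × X => p.1 - t) (𝓝 (t, x)) (𝓝 0) := by
    have : Continuous fun p : ℝ≥0 × X => p.1 - t := by fun_prop
    simpa using this.tendsto (t, x)
  have h2 : Tendsto (fun p : ℝ≥0 × X => t - p.1) (𝓝 (t, x)) (𝓝 0) := by
    have : Continuous fun p : ℝ≥0 × X => t - p.1 := by fun_prop
    simpa using this.tendsto (t, x)
  have h3 : Tendsto (fun p : ℝ≥0 × X => ‖p.2 - x‖) (𝓝 (t, x)) (𝓝 0) := by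
    have : Continuous fun p : ℝ≥0 × X => ‖p.2 - x‖ := by fun_prop
    simpa using this.tendsto (t, x)
  have hb := (h3.const_mul M).add (((hz.comp h1).const_mul M).add ((hz.comp h2).const_mul M))
  simp only [mul_zero, add_zero] at hb
  rw [ContinuousAt, tendsto_iff_norm_sub_tendsto_zero]
  refine squeeze_zero (fun _ => norm_nonneg _) (fun p => ?_) hb
  have : S p.1 p.2 - S t x = S p.1 (p.2 - x) + (S p.1 x - S t x) := by
    rw [map_sub]
    abel
  change ‖S p.1 p.2 - S t x‖ ≤ _
  rw [this]
  refine (norm_add_le _ _).trans (add_le_add ?_ (key p.1))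
  exact (S p.1).le_of_opNorm_le (hM _) _

theorem continuous_op (x : X) : Continuous fun u => T.op u x := by
  have h : ∀ l : List (Fin n),
      Continuous fun u : Fin n → ℝ≥0 => (l.map fun j => (T.part j).op (u j)).prod x := by
    intro l
    induction l with
    | nil => simpa using continuous_const
    | cons j l ih =>
      simp only [List.map_cons, List.prod_cons]
      exact (T.continuous_part j).comp ((continuous_apply j).prodMk ih)
  simpa only [op, List.ofFn_eq_map] using h (List.finRange n)

theorem exists_bound : ∃ M : ℝ, ∀ u, ‖T.op u‖ ≤ M := by
  have h : ∀ l : List (Fin n),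
      ∃ M : ℝ, ∀ u : Fin n → ℝ≥0, ‖(l.map fun j => (T.part j).op (u j)).prod‖ ≤ M := by
    intro l
    induction l with
    | nil => exact ⟨‖(1 : X →L[ℂ] X)‖, fun u => by simp⟩
    | cons j l ih =>
      obtain ⟨M, hM⟩ := ih
      obtain ⟨N, hN⟩ := T.bounded j
      refine ⟨N * M, fun u => ?_⟩
      simp only [List.map_cons, List.prod_cons]
      exact (norm_mul_le _ _).trans
        (mul_le_mul (hN _) (hM u) (norm_nonneg _) ((norm_nonneg _).trans (hN 0)))
  simpa only [op, List.ofFn_eq_map] using h (List.finRange n)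

theorem integrable_op (ν : FiniteMeasure (Fin n → ℝ≥0)) (x : X) :
    Integrable (fun u => T.op u x) (ν : Measure (Fin n → ℝ≥0)) := by
  obtain ⟨M, hM⟩ := T.exists_bound
  refine Integrable.of_bound (T.continuous_op x).aestronglyMeasurable (M * ‖x‖) ?_
  exact Eventually.of_forall fun u => (T.op u).le_of_opNorm_le (hM u) x

/-- The bounded operator `x ↦ ∫ T(u) x dν(u)` (Bochner integral over `ℝ_+^n`). -/
def integralOp (ν : FiniteMeasure (Fin n → ℝ≥0)) : X →L[ℂ] X :=
  LinearMap.mkContinuousOfExistsBound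
    { toFun := fun x => ∫ u, T.op u x ∂(ν : Measure (Fin n → ℝ≥0))
      map_add' := fun x y => by
        simp only [map_add]
        exact integral_add (T.integrable_op ν x) (T.integrable_op ν y)
      map_smul' := fun c x => by
        simp only [map_smul, RingHom.id_apply]
        exact integral_smul c _ } (by
    obtain ⟨M, hM⟩ := T.exists_bound
    refine ⟨M * (ν : Measure (Fin n → ℝ≥0)).real Set.univ, fun x => ?_⟩
    refine (norm_integral_le_of_norm_le_const (C := M * ‖x‖)
      (Eventually.of_forall fun u => (T.op u).le_of_opNorm_le (hM u) x)).trans (le_of_eq ?_)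
    ring)

/-- The subordinated semigroup `g_t(A) x = ∫ T(u) x dν_t(u)`. -/
def subordinate (ψ : (Fin n → ℝ) → ℝ) (t : ℝ≥0) : X →L[ℂ] X := T.integralOp (subMeasure ψ t)

/-- The value `ψ(A)` of `ψ` on the tuple `A = (A_1, …, A_n)` of the generators
`A_j = generator (T.part j).op` in the multidimensional Bochner–Phillips calculus: the generator of the semigroup `g_t(A)`. -/
def bochnerPhillips (ψ : (Fin n → ℝ) → ℝ) : X →ₗ.[ℂ] X := generator (T.subordinate ψ)

end MultiSemigroup

/-! ### Function spaces of class `𝒞` -/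

/-- Test functions: smooth compactly supported complex functions on `ℝ^n`. -/
def IsTestFunction {n : ℕ} (φ : (Fin n → ℝ) → ℂ) : Prop := ContDiff ℝ ∞ φ ∧ HasCompactSupport φ

/-- `T` is the translation semigroup `(T(u) x)(s) = x(u + s)`, `u ∈ ℝ_+^n`, of a space `X` whose
elements are regarded as functions on `ℝ^n` through `ev`. -/
def IsTranslation {n : ℕ} (ev : X →ₗ[ℂ] ((Fin n → ℝ) → ℂ)) (T : MultiSemigroup n X) : Prop :=
  ∀ (u : Fin n → ℝ≥0) (x : X) (s : Fin n → ℝ), ev (T.op u x) s = ev x (fun j => (u j : ℝ) + s j)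

/-- The space `X`, whose elements are regarded as functions on `ℝ^n` through the injective linear
map `ev`, is a complex Banach space of functions of the class `𝒞`. -/
structure IsClassC {n : ℕ} (ev : X →ₗ[ℂ] ((Fin n → ℝ) → ℂ)) : Prop where
  complete : CompleteSpace X
  injective : Function.Injective ev
  test_mem : ∀ φ, IsTestFunction φ → ∃ x, ev x = φ
  tendsto_of_uniform : ∀ (x : ℕ → X) (K : Set (Fin n → ℝ)), IsCompact K →
    (∀ k, IsTestFunction (ev (x k))) → (∀ k, tsupport (ev (x k)) ⊆ K) →
    TendstoUniformly (fun k => ev (x k)) 0 atTop → Tendsto x atTop (𝓝 0)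
  eval_zero : ∀ x : ℕ → X, Tendsto x atTop (𝓝 0) →
    ∃ m : ℕ → ℕ, StrictMono m ∧ Tendsto (fun i => ev (x (m i)) 0) atTop (𝓝 0)
  translation : ∃ T : MultiSemigroup n X, IsTranslation ev T

end Semigroups

/-- `C₀(ℝ^n)` as a space of functions on `ℝ^n`. -/
def evC0 (n : ℕ) : C₀(Fin n → ℝ, ℂ) →ₗ[ℂ] ((Fin n → ℝ) → ℂ) where
  toFun f := f
  map_add' _ _ := rfl
  map_smul' _ _ := rfl

/-- `UCB(ℝ^n)`: bounded uniformly continuous functions on `ℝ^n`, with the sup-norm. -/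
def UCB (n : ℕ) : Submodule ℂ ((Fin n → ℝ) →ᵇ ℂ) where
  carrier := {f | UniformContinuous f}
  zero_mem' := uniformContinuous_const
  add_mem' hf hg := UniformContinuous.add hf hg
  smul_mem' c _ hf := UniformContinuous.const_smul hf c

/-- `UCB(ℝ^n)` as a space of functions on `ℝ^n`. -/
def evUCB (n : ℕ) : UCB n →ₗ[ℂ] ((Fin n → ℝ) → ℂ) where
  toFun f := f.1
  map_add' _ _ := rfl
  map_smul' _ _ := rfl

end BochnerPhillips

end

universe u v

/-!
Everything rests on Bernstein's theorem in `n` variables, `exists_hasLaplaceTransform`: a bounded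
absolutely monotone function `f` on `(-∞, 0)^n` is the Laplace transform of a finite measure on
`ℝ_+^n`. Its proof goes through a moment problem. Absolute monotonicity makes all iterated
differences of `f` nonnegative, so that the values of `f` on a lattice of mesh `h` define a
functional on polynomials which is nonnegative on products of Bernstein polynomials. The resulting
discrete measures on the cube `[0, 1]^n` have a weak limit whose moments are these values
(`exists_measure_moments`); letting `h → 0` and substituting `y = exp (-u)` gives the measure on
`ℝ_+^n`. Since `exp (t ψ)` is absolutely monotone for a Bernstein function `ψ`, the measures `ν_t`
exist, and they are determined by their transforms (`HasLaplaceTransform.unique`).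

If `|ψ| ≤ K`, then `ψ + K` is itself absolutely monotone and has a representing measure `μ`. As
`exp (t (ψ + K)) - 1 - t (ψ + K)` is absolutely monotone as well, uniqueness gives
`ν_t = exp (-t K) (δ_0 + t μ + ρ_t)` with `ρ_t` of mass `O(t ^ 2)`. Hence `ψ(A) x` exists for every
`x` and equals `∫ T(u) x dμ(u) - K x`, which gives the constant `K + M ^ n K`.

Conversely, `g_t(∂)` is a bounded `C₀`-semigroup, because `ν_(s + t)` is the convolution of `ν_s`
and `ν_t` and because `ν_t → δ_0`. Since `∫_0^r g_σ x dσ` lies in the domain of the generator and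
is mapped to `g_r x - x`, a bounded generator forces `‖g_r x - x‖ ≤ L r ‖x‖` for all `x`. Evaluation
at `0` is a continuous functional, and bump functions supported in the unit ball are bounded in
norm, so that `∫ β dν_t ≥ 1 - c t` for all bumps `β` at the origin with one constant `c`. Shrinking
the support of `β` yields `exp (t ψ(s)) ≥ 1 - c t` for all `s`, that is, `ψ ≥ -c`.

For the sup-norm spaces of uniformly continuous functions, strong continuity of translations is
uniform continuity of the functions.
-/

open Filter Topology MeasureTheory
open scoped NNReal ContDiff ZeroAtInfty BoundedContinuousFunction

noncomputable section

namespace BochnerPhillips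

/-! ### Absolutely monotone functions -/

section AbsolutelyMonotone

variable {n : ℕ}

theorem isOpen_negOrthant (n : ℕ) : IsOpen (negOrthant n) := by
  have : negOrthant n = Set.univ.pi fun _ => Set.Iio (0 : ℝ) := by
    ext s
    simp [negOrthant]
  rw [this]
  exact isOpen_set_pi Set.finite_univ fun _ _ => isOpen_Iio

theorem convex_negOrthant (n : ℕ) : Convex ℝ (negOrthant n) := by
  have : negOrthant n = Set.univ.pi fun _ => Set.Iio (0 : ℝ) := by
    ext s
    simp [negOrthant]
  rw [this]
  exact convex_pi fun _ _ => convex_Iio 0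

theorem negOrthant_mem_nhds {s : Fin n → ℝ} (hs : s ∈ negOrthant n) : negOrthant n ∈ 𝓝 s :=
  (isOpen_negOrthant n).mem_nhds hs

theorem sub_mem_negOrthant {s c : Fin n → ℝ} (hs : s ∈ negOrthant n) (hc : 0 ≤ c) :
    s - c ∈ negOrthant n := fun j => by
  have h1 := hs j
  have h2 := hc j
  simp only [Pi.zero_apply, Pi.sub_apply] at *
  linarith

theorem differentiableAt_of_smooth {f : (Fin n → ℝ) → ℝ} (hf : ContDiffOn ℝ ∞ f (negOrthant n))
    {s : Fin n → ℝ} (hs : s ∈ negOrthant n) : DifferentiableAt ℝ f s :=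
  ((hf.contDiffAt (negOrthant_mem_nhds hs)).differentiableAt (by simp))

theorem contDiffOn_partialDeriv {f : (Fin n → ℝ) → ℝ} (hf : ContDiffOn ℝ ∞ f (negOrthant n))
    (j : Fin n) : ContDiffOn ℝ ∞ (partialDeriv j f) (negOrthant n) :=
  (hf.fderiv_of_isOpen (isOpen_negOrthant n) (m := ∞) (by simp)).clm_apply contDiffOn_const

/-- The innermost derivative of an iterated derivative can be split off as a partial derivative. -/
theorem iteratedFDeriv_succ_eq_partialDeriv {f : (Fin n → ℝ) → ℝ}
    (hf : ContDiffOn ℝ ∞ f (negOrthant n)) {s : Fin n → ℝ} (hs : s ∈ negOrthant n) {k : ℕ}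
    (v : Fin (k + 1) → Fin n) :
    iteratedFDeriv ℝ (k + 1) f s (fun i => Pi.single (v i) 1) =
      iteratedFDeriv ℝ k (partialDeriv (v (Fin.last k)) f) s
        (fun i => Pi.single (v i.castSucc) 1) := by
  rw [iteratedFDeriv_succ_apply_right]
  have hd : ContDiffAt ℝ k (fderiv ℝ f) s :=
    ((hf.fderiv_of_isOpen (isOpen_negOrthant n) (m := ∞) (by simp)).contDiffAt
      (negOrthant_mem_nhds hs)).of_le (by exact_mod_cast le_top)
  have := (ContinuousLinearMap.apply ℝ ℝ
    (Pi.single (v (Fin.last k)) (1 : ℝ) : Fin n → ℝ)).iteratedFDeriv_comp_left hd (i := k) le_rfl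
  change _ = (iteratedFDeriv ℝ k ((ContinuousLinearMap.apply ℝ ℝ
    (Pi.single (v (Fin.last k)) (1 : ℝ) : Fin n → ℝ)) ∘ fderiv ℝ f) s) _
  rw [this]
  rfl

/-- Coinduction principle: the members of a class of smooth nonnegative functions that is closed
under the partial derivatives are absolutely monotone. -/
theorem isAbsolutelyMonotone_of_class (P : ((Fin n → ℝ) → ℝ) → Prop)
    (smooth : ∀ f, P f → ContDiffOn ℝ ∞ f (negOrthant n))
    (nonneg : ∀ f, P f → ∀ s ∈ negOrthant n, 0 ≤ f s)
    (partials : ∀ f, P f → ∀ j, ∃ g, P g ∧ Set.EqOn (partialDeriv j f) g (negOrthant n))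
    {f : (Fin n → ℝ) → ℝ} (hf : P f) : IsAbsolutelyMonotone f := by
  refine ⟨smooth f hf, fun k => ?_⟩
  induction k generalizing f with
  | zero =>
    intro v s hs
    simpa using nonneg f hf s hs
  | succ k ih =>
    intro v s hs
    rw [iteratedFDeriv_succ_eq_partialDeriv (smooth f hf) hs]
    obtain ⟨g, hg, he⟩ := partials f hf (v (Fin.last k))
    have : partialDeriv (v (Fin.last k)) f =ᶠ[𝓝 s] g :=
      he.eventuallyEq_of_mem (negOrthant_mem_nhds hs)
    rw [(this.iteratedFDeriv ℝ k).eq_of_nhds]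
    exact ih hg _ s hs

namespace IsAbsolutelyMonotone

variable {f g : (Fin n → ℝ) → ℝ}

theorem apply_nonneg (hf : IsAbsolutelyMonotone f) {s : Fin n → ℝ} (hs : s ∈ negOrthant n) :
    0 ≤ f s := by
  simpa using hf.nonneg 0 Fin.elim0 s hs

theorem differentiableAt (hf : IsAbsolutelyMonotone f) {s : Fin n → ℝ} (hs : s ∈ negOrthant n) :
    DifferentiableAt ℝ f s := differentiableAt_of_smooth hf.smooth hs

theorem partialDeriv (hf : IsAbsolutelyMonotone f) (j : Fin n) :
    IsAbsolutelyMonotone (partialDeriv j f) := by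
  refine ⟨contDiffOn_partialDeriv hf.smooth j, fun k v s hs => ?_⟩
  have := hf.nonneg (k + 1) (Fin.snoc v j) s hs
  rw [iteratedFDeriv_succ_eq_partialDeriv hf.smooth hs] at this
  simpa using this

/-- A nonnegative function with absolutely monotone first partial derivatives is absolutely
monotone. -/
theorem of_partials (hs : ContDiffOn ℝ ∞ f (negOrthant n)) (h0 : ∀ s ∈ negOrthant n, 0 ≤ f s)
    (hp : ∀ j, ∃ g, IsAbsolutelyMonotone g ∧
      Set.EqOn (BochnerPhillips.partialDeriv j f) g (negOrthant n)) :
    IsAbsolutelyMonotone f := by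
  refine isAbsolutelyMonotone_of_class (fun h => IsAbsolutelyMonotone h ∨ h = f) ?_ ?_ ?_
    (Or.inr rfl)
  · rintro h (hh | rfl)
    exacts [hh.smooth, hs]
  · rintro h (hh | rfl)
    exacts [fun s => hh.apply_nonneg, h0]
  · rintro h (hh | rfl) j
    · exact ⟨_, Or.inl (hh.partialDeriv j), fun _ _ => rfl⟩
    · obtain ⟨g, hg, he⟩ := hp j
      exact ⟨g, Or.inl hg, he⟩

theorem const {c : ℝ} (hc : 0 ≤ c) : IsAbsolutelyMonotone (fun _ : Fin n → ℝ => c) := by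
  refine isAbsolutelyMonotone_of_class (fun h => ∃ c, 0 ≤ c ∧ h = fun _ => c) ?_ ?_ ?_ ⟨c, hc, rfl⟩
  · rintro h ⟨c, hc, rfl⟩
    exact contDiffOn_const
  · rintro h ⟨c, hc, rfl⟩ s hs
    exact hc
  · rintro h ⟨c, hc, rfl⟩ j
    exact ⟨fun _ => 0, ⟨0, le_rfl, rfl⟩, fun s _ => by simp [BochnerPhillips.partialDeriv]⟩

theorem add (hf : IsAbsolutelyMonotone f) (hg : IsAbsolutelyMonotone g) :
    IsAbsolutelyMonotone (fun s => f s + g s) := by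
  refine isAbsolutelyMonotone_of_class (fun h => ∃ f g, IsAbsolutelyMonotone f ∧
    IsAbsolutelyMonotone g ∧ h = fun s => f s + g s) ?_ ?_ ?_ ⟨f, g, hf, hg, rfl⟩
  · rintro h ⟨f, g, hf, hg, rfl⟩
    exact hf.smooth.add hg.smooth
  · rintro h ⟨f, g, hf, hg, rfl⟩ s hs
    exact add_nonneg (hf.apply_nonneg hs) (hg.apply_nonneg hs)
  · rintro h ⟨f, g, hf, hg, rfl⟩ j
    refine ⟨_, ⟨_, _, hf.partialDeriv j, hg.partialDeriv j, rfl⟩, fun s hs => ?_⟩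
    simp only [BochnerPhillips.partialDeriv]
    rw [fderiv_fun_add (hf.differentiableAt hs) (hg.differentiableAt hs)]
    rfl

/-- Finite sums of products of two absolutely monotone functions. By the Leibniz rule they form a
class closed under partial derivatives. -/
inductive SumOfProducts : ((Fin n → ℝ) → ℝ) → Prop
  | mul {f g : (Fin n → ℝ) → ℝ} (hf : IsAbsolutelyMonotone f) (hg : IsAbsolutelyMonotone g) :
      SumOfProducts fun s => f s * g s
  | add {f g : (Fin n → ℝ) → ℝ} (hf : SumOfProducts f) (hg : SumOfProducts g) :
      SumOfProducts fun s => f s + g s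

theorem SumOfProducts.smooth (hf : SumOfProducts f) : ContDiffOn ℝ ∞ f (negOrthant n) := by
  induction hf with
  | mul hf hg => exact hf.smooth.mul hg.smooth
  | add _ _ ihf ihg => exact ihf.add ihg

theorem mul (hf : IsAbsolutelyMonotone f) (hg : IsAbsolutelyMonotone g) :
    IsAbsolutelyMonotone (fun s => f s * g s) := by
  refine isAbsolutelyMonotone_of_class SumOfProducts (fun h hh => hh.smooth) ?_ ?_ (.mul hf hg)
  · intro h hh
    induction hh with
    | mul hf hg => exact fun s hs => mul_nonneg (hf.apply_nonneg hs) (hg.apply_nonneg hs)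
    | add _ _ ihf ihg => exact fun s hs => add_nonneg (ihf s hs) (ihg s hs)
  · intro h hh j
    induction hh with
    | @mul f g hf hg =>
      refine ⟨_, .add (.mul hf (hg.partialDeriv j)) (.mul (hf.partialDeriv j) hg), fun s hs => ?_⟩
      simp only [BochnerPhillips.partialDeriv]
      rw [fderiv_fun_mul (hf.differentiableAt hs) (hg.differentiableAt hs)]
      simp [mul_comm]
    | add hf hg ihf ihg =>
      obtain ⟨f', hf', ef⟩ := ihf
      obtain ⟨g', hg', eg⟩ := ihg
      refine ⟨_, .add hf' hg', fun s hs => ?_⟩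
      simp only [← ef hs, ← eg hs, BochnerPhillips.partialDeriv]
      rw [fderiv_fun_add (differentiableAt_of_smooth hf.smooth hs)
        (differentiableAt_of_smooth hg.smooth hs)]
      rfl

theorem const_mul {c : ℝ} (hc : 0 ≤ c) (hf : IsAbsolutelyMonotone f) :
    IsAbsolutelyMonotone (fun s => c * f s) := (const hc).mul hf

end IsAbsolutelyMonotone

theorem partialDeriv_exp {φ : (Fin n → ℝ) → ℝ} (hφ : ContDiffOn ℝ ∞ φ (negOrthant n)) (t : ℝ)
    (j : Fin n) {s : Fin n → ℝ} (hs : s ∈ negOrthant n) :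
    partialDeriv j (fun s => Real.exp (t * φ s)) s =
      t * partialDeriv j φ s * Real.exp (t * φ s) := by
  have h : HasFDerivAt φ (fderiv ℝ φ s) s := (differentiableAt_of_smooth hφ hs).hasFDerivAt
  have h2 := (h.const_mul t).exp
  simp only [partialDeriv]
  rw [h2.fderiv]
  simp only [smul_apply, smul_eq_mul]
  ring

theorem contDiffOn_exp {φ : (Fin n → ℝ) → ℝ} (hφ : ContDiffOn ℝ ∞ φ (negOrthant n)) (t : ℝ) :
    ContDiffOn ℝ ∞ (fun s => Real.exp (t * φ s)) (negOrthant n) :=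
  (contDiffOn_const.mul hφ).exp

/-- The exponential of a function with absolutely monotone first partial derivatives is absolutely
monotone: the functions `a * exp (t φ)`, with `a` absolutely monotone, form a class closed under
partial derivatives. -/
theorem isAbsolutelyMonotone_exp {φ : (Fin n → ℝ) → ℝ} (hφ : ContDiffOn ℝ ∞ φ (negOrthant n))
    (hp : ∀ j, IsAbsolutelyMonotone (partialDeriv j φ)) {t : ℝ} (ht : 0 ≤ t) :
    IsAbsolutelyMonotone (fun s => Real.exp (t * φ s)) := by
  refine isAbsolutelyMonotone_of_class (fun h => ∃ a, IsAbsolutelyMonotone a ∧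
    h = fun s => a s * Real.exp (t * φ s)) ?_ ?_ ?_
    ⟨fun _ => 1, .const zero_le_one, by simp⟩
  · rintro h ⟨a, ha, rfl⟩
    exact ha.smooth.mul (contDiffOn_exp hφ t)
  · rintro h ⟨a, ha, rfl⟩ s hs
    exact mul_nonneg (ha.apply_nonneg hs) (Real.exp_pos _).le
  · rintro h ⟨a, ha, rfl⟩ j
    refine ⟨_, ⟨_, (ha.partialDeriv j).add ((ha.mul (hp j)).const_mul ht), rfl⟩, fun s hs => ?_⟩
    have h1 := partialDeriv_exp hφ t j hs
    simp only [partialDeriv] at h1 ⊢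
    rw [fderiv_fun_mul (ha.differentiableAt hs)
      (differentiableAt_of_smooth (contDiffOn_exp hφ t) hs)]
    simp only [add_apply, smul_apply, smul_eq_mul, h1]
    ring

/-- The remainder `exp (t φ) - 1 - t φ` of first order is again absolutely monotone. -/
theorem IsAbsolutelyMonotone.exp_sub_one_sub {φ : (Fin n → ℝ) → ℝ} (hφ : IsAbsolutelyMonotone φ)
    {t : ℝ} (ht : 0 ≤ t) :
    IsAbsolutelyMonotone (fun s => Real.exp (t * φ s) - 1 - t * φ s) := by
  have he := isAbsolutelyMonotone_exp hφ.smooth hφ.partialDeriv ht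
  have h1 : IsAbsolutelyMonotone (fun s => Real.exp (t * φ s) - 1) := by
    refine of_partials (he.smooth.sub contDiffOn_const) (fun s hs => ?_)
      fun j => ⟨_, ((hφ.partialDeriv j).const_mul ht).mul he, fun s hs => ?_⟩
    · have := Real.one_le_exp (mul_nonneg ht (hφ.apply_nonneg hs))
      linarith
    · rw [← partialDeriv_exp hφ.smooth t j hs]
      simp only [BochnerPhillips.partialDeriv, fderiv_sub_const]
  refine of_partials (h1.smooth.sub (contDiffOn_const.mul hφ.smooth)) (fun s hs => ?_)
    fun j => ⟨_, ((hφ.partialDeriv j).const_mul ht).mul h1, fun s hs => ?_⟩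
  · have := Real.add_one_le_exp (t * φ s)
    linarith
  · have h2 := partialDeriv_exp hφ.smooth t j hs
    simp only [BochnerPhillips.partialDeriv] at h2 ⊢
    rw [fderiv_fun_sub (h1.differentiableAt hs) ((hφ.differentiableAt hs).const_mul t),
      fderiv_sub_const, fderiv_const_mul (hφ.differentiableAt hs)]
    simp only [sub_apply, smul_apply, smul_eq_mul, h2]
    ring

theorem le_of_partialDeriv_nonneg {f : (Fin n → ℝ) → ℝ} (hf : ContDiffOn ℝ ∞ f (negOrthant n))
    (hp : ∀ j, ∀ s ∈ negOrthant n, 0 ≤ partialDeriv j f s) {s s' : Fin n → ℝ}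
    (hs : s ∈ negOrthant n) (hs' : s' ∈ negOrthant n) (hle : s ≤ s') : f s ≤ f s' := by
  obtain ⟨z, hz, he⟩ := domain_mvt (f := f) (f' := fun x => fderiv ℝ f x)
    (fun x hx => (differentiableAt_of_smooth hf hx).hasFDerivAt.hasFDerivWithinAt)
    (convex_negOrthant n) hs hs'
  have hz' := (convex_negOrthant n).segment_subset hs hs' hz
  have : 0 ≤ fderiv ℝ f z (s' - s) := by
    have hsum : s' - s = ∑ j, (s' j - s j) • (Pi.single j (1 : ℝ) : Fin n → ℝ) := by
      rw [pi_eq_sum_univ' (s' - s)]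
      rfl
    rw [hsum, map_sum]
    refine Finset.sum_nonneg fun j _ => ?_
    rw [map_smul]
    exact smul_nonneg (sub_nonneg.2 (hle j)) (hp j z hz')
  linarith

theorem IsAbsolutelyMonotone.mono {f : (Fin n → ℝ) → ℝ} (hf : IsAbsolutelyMonotone f)
    {s s' : Fin n → ℝ} (hs : s ∈ negOrthant n) (hs' : s' ∈ negOrthant n) (hle : s ≤ s') :
    f s ≤ f s' :=
  le_of_partialDeriv_nonneg hf.smooth (fun j _ hs => (hf.partialDeriv j).apply_nonneg hs) hs hs' hle

theorem partialDeriv_comp_sub {f : (Fin n → ℝ) → ℝ} (c s : Fin n → ℝ) (j : Fin n) :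
    partialDeriv j (fun s => f (s - c)) s = partialDeriv j f (s - c) := by
  simp only [partialDeriv]
  rw [fderiv_comp_sub]

theorem contDiffOn_comp_sub {f : (Fin n → ℝ) → ℝ} (hf : ContDiffOn ℝ ∞ f (negOrthant n))
    {c : Fin n → ℝ} (hc : 0 ≤ c) : ContDiffOn ℝ ∞ (fun s => f (s - c)) (negOrthant n) :=
  hf.comp (contDiffOn_id.sub contDiffOn_const) fun _ hs => sub_mem_negOrthant hs hc

theorem IsAbsolutelyMonotone.comp_sub {f : (Fin n → ℝ) → ℝ} (hf : IsAbsolutelyMonotone f)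
    {c : Fin n → ℝ} (hc : 0 ≤ c) : IsAbsolutelyMonotone (fun s => f (s - c)) := by
  refine isAbsolutelyMonotone_of_class (fun h => ∃ f, IsAbsolutelyMonotone f ∧
    h = fun s => f (s - c)) ?_ ?_ ?_ ⟨f, hf, rfl⟩
  · rintro h ⟨f, hf, rfl⟩
    exact contDiffOn_comp_sub hf.smooth hc
  · rintro h ⟨f, hf, rfl⟩ s hs
    exact hf.apply_nonneg (sub_mem_negOrthant hs hc)
  · rintro h ⟨f, hf, rfl⟩ j
    exact ⟨_, ⟨_, hf.partialDeriv j, rfl⟩, fun s _ => partialDeriv_comp_sub c s j⟩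

theorem IsAbsolutelyMonotone.sub_comp_sub {f : (Fin n → ℝ) → ℝ} (hf : IsAbsolutelyMonotone f)
    {c : Fin n → ℝ} (hc : 0 ≤ c) : IsAbsolutelyMonotone (fun s => f s - f (s - c)) := by
  refine isAbsolutelyMonotone_of_class (fun h => ∃ f, IsAbsolutelyMonotone f ∧
    h = fun s => f s - f (s - c)) ?_ ?_ ?_ ⟨f, hf, rfl⟩
  · rintro h ⟨f, hf, rfl⟩
    exact hf.smooth.sub (contDiffOn_comp_sub hf.smooth hc)
  · rintro h ⟨f, hf, rfl⟩ s hs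
    exact sub_nonneg.2 (hf.mono (sub_mem_negOrthant hs hc) hs (sub_le_self s hc))
  · rintro h ⟨f, hf, rfl⟩ j
    refine ⟨_, ⟨_, hf.partialDeriv j, rfl⟩, fun s hs => ?_⟩
    rw [← partialDeriv_comp_sub c s j]
    simp only [BochnerPhillips.partialDeriv]
    rw [fderiv_fun_sub (hf.differentiableAt hs)
      (differentiableAt_of_smooth (contDiffOn_comp_sub hf.smooth hc) hs)]
    rfl

end AbsolutelyMonotone

/-! ### Moments on the cube -/

section Moments

open MvPolynomial Finset

variable {n : ℕ}

/-- The linear functional on polynomials in `n` variables with `X ^ m ↦ f (b - h m)`: each `X_j`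
stands for the shift by `-h` in the `j`-th variable, followed by evaluation at `b`. -/
def shiftEval (f : (Fin n → ℝ) → ℝ) (b : Fin n → ℝ) (h : ℝ) : MvPolynomial (Fin n) ℝ →ₗ[ℝ] ℝ :=
  (basisMonomials (Fin n) ℝ).constr ℝ fun m => f fun j => b j - h * m j

variable {f : (Fin n → ℝ) → ℝ} {b : Fin n → ℝ} {h : ℝ}

theorem shiftEval_monomial (m : Fin n →₀ ℕ) (c : ℝ) :
    shiftEval f b h (monomial m c) = c * f fun j => b j - h * m j := by
  have h1 : monomial m c = c • (basisMonomials (Fin n) ℝ) m := by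
    simp [smul_monomial]
  rw [h1, map_smul, shiftEval, Module.Basis.constr_basis, smul_eq_mul]

theorem shiftEval_one : shiftEval f b h 1 = f b := by
  rw [← C_1, ← monomial_zero', shiftEval_monomial]
  simp

theorem shiftEval_sub (g : (Fin n → ℝ) → ℝ) (P : MvPolynomial (Fin n) ℝ) :
    shiftEval (fun s => f s - g s) b h P = shiftEval f b h P - shiftEval g b h P := by
  induction P using MvPolynomial.induction_on' with
  | monomial m c => simp only [shiftEval_monomial, mul_sub]
  | add P Q hP hQ => rw [map_add, map_add, map_add, hP, hQ]; ring

theorem shiftEval_mul_X (P : MvPolynomial (Fin n) ℝ) (j : Fin n) :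
    shiftEval f b h (P * X j) = shiftEval (fun s => f (s - Pi.single j h)) b h P := by
  induction P using MvPolynomial.induction_on' with
  | monomial m c =>
    rw [X, monomial_mul, mul_one, shiftEval_monomial, shiftEval_monomial]
    congr 2
    ext i
    by_cases hi : i = j
    · subst hi
      simp
      ring
    · simp [hi]
  | add P Q hP hQ => rw [add_mul, map_add, map_add, hP, hQ]

theorem shiftEval_mul_one_sub_X (P : MvPolynomial (Fin n) ℝ) (j : Fin n) :
    shiftEval f b h (P * (1 - X j)) =
      shiftEval (fun s => f s - f (s - Pi.single j h)) b h P := by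
  rw [mul_sub, mul_one, map_sub, shiftEval_mul_X, shiftEval_sub]

/-- The polynomials by which one may multiply without losing nonnegativity under `shiftEval f b h`
for all absolutely monotone `f`. -/
def positiveMultipliers (b : Fin n → ℝ) (h : ℝ) : Submonoid (MvPolynomial (Fin n) ℝ) where
  carrier := {P | ∀ Q, (∀ f, IsAbsolutelyMonotone f → 0 ≤ shiftEval f b h Q) →
    ∀ f, IsAbsolutelyMonotone f → 0 ≤ shiftEval f b h (Q * P)}
  one_mem' := fun Q hQ => by simpa using hQ
  mul_mem' := fun {P₁ P₂} h₁ h₂ Q hQ => by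
    rw [← mul_assoc]
    exact h₂ _ (h₁ Q hQ)

theorem X_mem_positiveMultipliers (hh : 0 ≤ h) (j : Fin n) :
    X j ∈ positiveMultipliers b h := fun Q hQ f hf => by
  rw [shiftEval_mul_X]
  exact hQ _ (hf.comp_sub (Pi.single_nonneg.2 hh))

theorem one_sub_X_mem_positiveMultipliers (hh : 0 ≤ h) (j : Fin n) :
    1 - X j ∈ positiveMultipliers b h := fun Q hQ f hf => by
  rw [shiftEval_mul_one_sub_X]
  exact hQ _ (hf.sub_comp_sub (Pi.single_nonneg.2 hh))

theorem natCast_mem_positiveMultipliers (k : ℕ) :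
    (k : MvPolynomial (Fin n) ℝ) ∈ positiveMultipliers b h := fun Q hQ f hf => by
  rw [mul_comm, ← nsmul_eq_mul, map_nsmul]
  exact nsmul_nonneg (hQ f hf) k

/-- The `k`-th Bernstein polynomial of degree `N` in each of the `n` variables. -/
def multiBernstein (N : ℕ) (k : Fin n → ℕ) : MvPolynomial (Fin n) ℝ :=
  ∏ j, ((N.choose (k j) : MvPolynomial (Fin n) ℝ) * X j ^ k j * (1 - X j) ^ (N - k j))

theorem shiftEval_multiBernstein_nonneg (hf : IsAbsolutelyMonotone f) (hb : b ∈ negOrthant n)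
    (hh : 0 ≤ h) (N : ℕ) (k : Fin n → ℕ) : 0 ≤ shiftEval f b h (multiBernstein N k) := by
  have hm : multiBernstein N k ∈ positiveMultipliers b h :=
    Submonoid.prod_mem _ fun j _ => mul_mem (mul_mem (natCast_mem_positiveMultipliers _)
      (pow_mem (X_mem_positiveMultipliers hh j) _))
      (pow_mem (one_sub_X_mem_positiveMultipliers hh j) _)
  have := hm 1 (fun f hf => by rw [shiftEval_one]; exact hf.apply_nonneg hb) f hf
  rwa [one_mul] at this

/-- The `p`-th factorial moment of the binomial distribution, as a polynomial identity. -/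
theorem sum_descFactorial_mul_bernstein {R : Type*} [CommRing R] (x : R) {p N : ℕ} (hpN : p ≤ N) :
    ∑ k ∈ range (N + 1), (k.descFactorial p : R) * (N.choose k * x ^ k * (1 - x) ^ (N - k)) =
      N.descFactorial p * x ^ p := by
  obtain ⟨M, rfl⟩ := Nat.exists_eq_add_of_le hpN
  rw [add_assoc, Finset.sum_range_add, Finset.sum_eq_zero, zero_add]
  · have h1 : x ^ p = x ^ p * (x + (1 - x)) ^ M := by simp
    rw [h1, add_pow, Finset.mul_sum, Finset.mul_sum]
    refine Finset.sum_congr rfl fun i hi => ?_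
    have h2 : (p + i).descFactorial p * (p + M).choose (p + i) =
        (p + M).descFactorial p * M.choose i := by
      have hi' : i ≤ M := Nat.lt_succ_iff.1 (Finset.mem_range.1 hi)
      have := Nat.choose_mul (n := p + M) (k := p + i) (s := p) (by omega)
      rw [Nat.add_sub_cancel_left, Nat.add_sub_cancel_left] at this
      rw [Nat.descFactorial_eq_factorial_mul_choose, Nat.descFactorial_eq_factorial_mul_choose,
        mul_assoc, mul_assoc, ← this]
      ring
    have h3 : ((p + i).descFactorial p : R) * (p + M).choose (p + i) =
        (p + M).descFactorial p * M.choose i := by exact_mod_cast congrArg (Nat.cast (R := R)) h2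
    rw [show p + M - (p + i) = M - i by omega]
    linear_combination x ^ (p + i) * (1 - x) ^ (M - i) * h3
  · intro k hk
    rw [Nat.descFactorial_eq_zero_iff_lt.2 (Finset.mem_range.1 hk)]
    simp

/-- Expansion of a monomial in Bernstein polynomials. -/
theorem prod_X_pow_eq_sum_multiBernstein {N : ℕ} {p : Fin n → ℕ} (hp : ∀ j, p j ≤ N) :
    ∏ j, (X j : MvPolynomial (Fin n) ℝ) ^ p j =
      ∑ k ∈ Fintype.piFinset fun _ => range (N + 1),
        (∏ j, ((k j).descFactorial (p j) / N.descFactorial (p j) : ℝ)) • multiBernstein N k := by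
  have h1 : ∀ j, (X j : MvPolynomial (Fin n) ℝ) ^ p j = ∑ k ∈ range (N + 1),
      C (k.descFactorial (p j) / N.descFactorial (p j) : ℝ) *
        ((N.choose k : MvPolynomial (Fin n) ℝ) * X j ^ k * (1 - X j) ^ (N - k)) := by
    intro j
    have h0 : (N.descFactorial (p j) : ℝ) ≠ 0 := by
      exact_mod_cast (Nat.descFactorial_eq_zero_iff_lt.not.2 (not_lt.2 (hp j)))
    have h2 := sum_descFactorial_mul_bernstein (X j : MvPolynomial (Fin n) ℝ) (hp j)
    have h3 := congrArg (fun P => C ((N.descFactorial (p j) : ℝ)⁻¹) * P) h2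
    rw [← mul_assoc, ← map_natCast C (N.descFactorial (p j)), ← C_mul, inv_mul_cancel₀ h0, C_1,
      one_mul] at h3
    rw [← h3, Finset.mul_sum]
    refine Finset.sum_congr rfl fun k _ => ?_
    rw [div_eq_inv_mul, C_mul, map_natCast]
    ring
  rw [Finset.prod_congr rfl fun j _ => h1 j, Finset.prod_univ_sum]
  refine Finset.sum_congr rfl fun k _ => ?_
  rw [Finset.prod_mul_distrib, multiBernstein, smul_eq_C_mul, map_prod]

theorem abs_prod_sub_prod_le {ι : Type*} (s : Finset ι) {x y : ι → ℝ}
    (hx : ∀ i ∈ s, x i ∈ Set.Icc (0 : ℝ) 1) (hy : ∀ i ∈ s, y i ∈ Set.Icc (0 : ℝ) 1) :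
    |∏ i ∈ s, x i - ∏ i ∈ s, y i| ≤ ∑ i ∈ s, |x i - y i| := by
  classical
  induction s using Finset.induction_on with
  | empty => simp
  | insert a s ha ih =>
    rw [Finset.prod_insert ha, Finset.prod_insert ha, Finset.sum_insert ha]
    have h1 := ih (fun i hi => hx i (Finset.mem_insert_of_mem hi))
      fun i hi => hy i (Finset.mem_insert_of_mem hi)
    have hxa := hx a (Finset.mem_insert_self a s)
    have hP : |∏ i ∈ s, y i| ≤ 1 := by
      rw [Finset.abs_prod]
      refine Finset.prod_le_one (fun _ _ => abs_nonneg _) fun i hi => ?_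
      have := hy i (Finset.mem_insert_of_mem hi)
      exact abs_le.2 ⟨by linarith [this.1], this.2⟩
    calc |x a * ∏ i ∈ s, x i - y a * ∏ i ∈ s, y i|
        = |x a * (∏ i ∈ s, x i - ∏ i ∈ s, y i) + (x a - y a) * ∏ i ∈ s, y i| := by ring_nf
      _ ≤ |x a| * |∏ i ∈ s, x i - ∏ i ∈ s, y i| + |x a - y a| * |∏ i ∈ s, y i| := by
          rw [← abs_mul, ← abs_mul]
          exact abs_add_le _ _
      _ ≤ 1 * |∏ i ∈ s, x i - ∏ i ∈ s, y i| + |x a - y a| * 1 := by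
          gcongr
          exact abs_le.2 ⟨by linarith [hxa.1], hxa.2⟩
      _ ≤ |x a - y a| + ∑ i ∈ s, |x i - y i| := by linarith

theorem natCast_div_mem_Icc {a b : ℕ} (h : a ≤ b) : (a / b : ℝ) ∈ Set.Icc (0 : ℝ) 1 :=
  ⟨by positivity, div_le_one_of_le₀ (by exact_mod_cast h) (by positivity)⟩

/-- Drawing `p` times from `N` objects, `k` of them marked, without and with replacement: both sides
are products of `p` factors which differ by at most `p / N`. -/
theorem abs_descFactorial_div_sub_pow_le {k p N : ℕ} (hk : k ≤ N) (hp : p ≤ N) :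
    |(k.descFactorial p / N.descFactorial p : ℝ) - (k / N : ℝ) ^ p| ≤ p * p / N := by
  have h1 : (k.descFactorial p / N.descFactorial p : ℝ) =
      ∏ i ∈ range p, (((k - i : ℕ) : ℝ) / ((N - i : ℕ) : ℝ)) := by
    rw [Nat.descFactorial_eq_prod_range, Nat.descFactorial_eq_prod_range, Nat.cast_prod,
      Nat.cast_prod, Finset.prod_div_distrib]
  have h2 : (k / N : ℝ) ^ p = ∏ _i ∈ range p, (k / N : ℝ) := by rw [prod_const, card_range]
  rw [h1, h2]
  refine (abs_prod_sub_prod_le _ (fun i _ => natCast_div_mem_Icc (by omega))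
    fun i _ => natCast_div_mem_Icc hk).trans ?_
  have h3 : ∀ i ∈ range p,
      |((k - i : ℕ) : ℝ) / ((N - i : ℕ) : ℝ) - (k / N : ℝ)| ≤ p / N := by
    intro i hi
    have hip : i < p := Finset.mem_range.1 hi
    have hiN : i < N := by omega
    have hN : (0 : ℝ) < N := by exact_mod_cast (by omega : 0 < N)
    have hip' : (i : ℝ) ≤ p := by exact_mod_cast hip.le
    have hiN' : (i : ℝ) < N := by exact_mod_cast hiN
    have hkN' : (k : ℝ) ≤ N := by exact_mod_cast hk
    rcases le_total i k with hik | hik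
    · rw [Nat.cast_sub hik, Nat.cast_sub hiN.le]
      have h4 : ((k : ℝ) - i) / (N - i) - k / N = -(i / N * ((N - k) / (N - i))) := by
        have : (N : ℝ) - i ≠ 0 := by linarith
        field_simp
        ring
      have h5 : ((N : ℝ) - k) / (N - i) ≤ 1 :=
        div_le_one_of_le₀ (by have : (i : ℝ) ≤ k := by exact_mod_cast hik
                              linarith) (by linarith)
      have h6 : 0 ≤ ((N : ℝ) - k) / (N - i) := div_nonneg (by linarith) (by linarith)
      rw [h4, abs_neg, abs_of_nonneg (by positivity)]
      calc (i : ℝ) / N * ((N - k) / (N - i)) ≤ i / N * 1 := by gcongr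
        _ ≤ p / N := by rw [mul_one]; gcongr
    · rw [Nat.sub_eq_zero_of_le hik]
      have : (k : ℝ) ≤ i := by exact_mod_cast hik
      simp only [Nat.cast_zero, zero_div, zero_sub, abs_neg]
      rw [abs_of_nonneg (by positivity)]
      gcongr
      linarith
  refine (Finset.sum_le_card_nsmul _ _ _ h3).trans (le_of_eq ?_)
  simp
  ring

/-- The discrete measure on the cube with the mass `shiftEval f b h (multiBernstein N k)` at the
grid point `k / N`. The projection to `[0, 1]` only serves to make this a point of the cube. -/
def bernsteinMeasure (f : (Fin n → ℝ) → ℝ) (b : Fin n → ℝ) (h : ℝ) (N : ℕ) :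
    Measure (Fin n → unitInterval) :=
  ∑ k ∈ Fintype.piFinset fun _ => range (N + 1),
    ENNReal.ofReal (shiftEval f b h (multiBernstein N k)) •
      Measure.dirac fun j => Set.projIcc (0 : ℝ) 1 zero_le_one (k j / N)

instance (N : ℕ) : IsFiniteMeasure (bernsteinMeasure f b h N) := by
  constructor
  simp only [bernsteinMeasure, Measure.coe_finsetSum, Finset.sum_apply]
  refine ENNReal.sum_lt_top.2 fun k _ => ?_
  simp

theorem integral_bernsteinMeasure (hf : IsAbsolutelyMonotone f) (hb : b ∈ negOrthant n)
    (hh : 0 ≤ h) (N : ℕ) (g : (Fin n → unitInterval) → ℝ) :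
    ∫ y, g y ∂bernsteinMeasure f b h N = ∑ k ∈ Fintype.piFinset fun _ => range (N + 1),
      shiftEval f b h (multiBernstein N k) *
        g fun j => Set.projIcc (0 : ℝ) 1 zero_le_one (k j / N) := by
  rw [bernsteinMeasure, integral_finsetSum_measure]
  · refine Finset.sum_congr rfl fun k _ => ?_
    rw [integral_smul_measure, integral_dirac,
      ENNReal.toReal_ofReal (shiftEval_multiBernstein_nonneg hf hb hh N k), smul_eq_mul]
  · intro k _
    exact (integrable_dirac (by simp)).smul_measure ENNReal.ofReal_ne_top

theorem sum_shiftEval_multiBernstein (N : ℕ) :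
    ∑ k ∈ Fintype.piFinset fun _ => range (N + 1), shiftEval f b h (multiBernstein N k) = f b := by
  have := congrArg (shiftEval f b h) (prod_X_pow_eq_sum_multiBernstein (n := n) (N := N)
    (p := 0) fun j => Nat.zero_le _)
  simpa [map_sum, shiftEval_one] using this.symm

theorem shiftEval_prod_X_pow (p : Fin n → ℕ) :
    shiftEval f b h (∏ j, X j ^ p j) = f fun j => b j - h * p j := by
  have h1 : ∏ j, (X j : MvPolynomial (Fin n) ℝ) ^ p j =
      monomial (Finsupp.equivFunOnFinite.symm p) 1 := by
    rw [monomial_eq, C_1, one_mul, Finsupp.prod_fintype _ _ fun _ => pow_zero _]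
    rfl
  rw [h1, shiftEval_monomial, one_mul]
  rfl

theorem abs_integral_bernsteinMeasure_sub_le (hf : IsAbsolutelyMonotone f) (hb : b ∈ negOrthant n)
    (hh : 0 ≤ h) {N : ℕ} (p : Fin n → ℕ) (hp : ∀ j, p j ≤ N) :
    |∫ y, ∏ j, (y j : ℝ) ^ p j ∂bernsteinMeasure f b h N - f fun j => b j - h * p j| ≤
      f b * (∑ j, (p j * p j / N : ℝ)) := by
  rw [integral_bernsteinMeasure hf hb hh, ← shiftEval_prod_X_pow (f := f) (b := b) (h := h) p,
    prod_X_pow_eq_sum_multiBernstein hp, map_sum, ← Finset.sum_sub_distrib,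
    ← sum_shiftEval_multiBernstein (f := f) (b := b) (h := h) N, Finset.sum_mul]
  refine (Finset.abs_sum_le_sum_abs _ _).trans (Finset.sum_le_sum fun k hk => ?_)
  have hk' : ∀ j, k j ≤ N := fun j =>
    Nat.lt_succ_iff.1 (Finset.mem_range.1 (Fintype.mem_piFinset.1 hk j))
  have hw := shiftEval_multiBernstein_nonneg hf hb hh N k
  rw [map_smul, smul_eq_mul, mul_comm _ (shiftEval f b h (multiBernstein N k)), ← mul_sub,
    abs_mul, abs_of_nonneg hw]
  refine mul_le_mul_of_nonneg_left ?_ hw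
  have h1 : ∀ j, ((Set.projIcc (0 : ℝ) 1 zero_le_one (k j / N) : unitInterval) : ℝ) = k j / N :=
    fun j => by rw [Set.projIcc_of_mem _ (natCast_div_mem_Icc (hk' j))]
  simp only [h1]
  refine (abs_prod_sub_prod_le _ (fun j _ => ?_) fun j _ => ?_).trans
    (Finset.sum_le_sum fun j _ => ?_)
  · have := natCast_div_mem_Icc (hk' j)
    exact ⟨pow_nonneg this.1 _, pow_le_one₀ this.1 this.2⟩
  · exact natCast_div_mem_Icc (Nat.descFactorial_le (p j) (hk' j))
  · rw [abs_sub_comm]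
    exact abs_descFactorial_div_sub_pow_le (hk' j) (hp j)

/-- Weak compactness for finite measures on the cube, phrased with an ultrafilter: bounded
sequences of measures converge weakly along `hyperfilter ℕ`. -/
theorem exists_tendsto_integral_hyperfilter (μ : ℕ → FiniteMeasure (Fin n → unitInterval))
    (K : ℝ≥0) (hK : ∀ k, (μ k).mass ≤ K) :
    ∃ ν : FiniteMeasure (Fin n → unitInterval), ∀ g : (Fin n → unitInterval) → ℝ, Continuous g →
      Tendsto (fun k => ∫ y, g y ∂(μ k : Measure (Fin n → unitInterval))) (hyperfilter ℕ)
        (𝓝 (∫ y, g y ∂(ν : Measure (Fin n → unitInterval)))) := by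
  obtain ⟨ν, -, hν⟩ := isCompact_iff_ultrafilter_le_nhds'.1
    (isCompact_setOfPred_finiteMeasure_le_of_compactSpace (Fin n → unitInterval) K)
    ((hyperfilter ℕ).map μ) (Filter.mem_map.2 (Filter.univ_mem' hK))
  refine ⟨ν, fun g hg => ?_⟩
  have h1 : Tendsto μ (hyperfilter ℕ) (𝓝 ν) := hν
  exact FiniteMeasure.tendsto_iff_forall_integral_tendsto.1 h1
    (BoundedContinuousFunction.mkOfCompact ⟨g, hg⟩)

/-- Multidimensional Hausdorff moment theorem for the values of an absolutely monotone function on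
a lattice: they are the moments of a measure on the cube. -/
theorem exists_measure_moments (hf : IsAbsolutelyMonotone f) (hb : b ∈ negOrthant n)
    (hh : 0 ≤ h) : ∃ ν : FiniteMeasure (Fin n → unitInterval), ∀ p : Fin n → ℕ,
      ∫ y, ∏ j, (y j : ℝ) ^ p j ∂(ν : Measure (Fin n → unitInterval)) =
        f fun j => b j - h * p j := by
  have hmass : ∀ N, FiniteMeasure.mass (⟨bernsteinMeasure f b h N, inferInstance⟩ :
      FiniteMeasure (Fin n → unitInterval)) ≤ (f b).toNNReal := by
    intro N
    have h1 := integral_bernsteinMeasure hf hb hh N fun _ => 1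
    simp only [mul_one, sum_shiftEval_multiBernstein, integral_const, smul_eq_mul] at h1
    rw [← h1]
    apply le_of_eq
    apply NNReal.eq
    rw [Real.coe_toNNReal _ (by positivity)]
    rfl
  obtain ⟨ν, hν⟩ := exists_tendsto_integral_hyperfilter _ _ hmass
  refine ⟨ν, fun p => tendsto_nhds_unique (hν (fun y => ∏ j, (y j : ℝ) ^ p j) (by fun_prop)) ?_⟩
  have hlim : Tendsto (fun N : ℕ => f b * (∑ j, (p j * p j / N : ℝ))) atTop (𝓝 0) := by
    have h1 : Tendsto (fun N : ℕ => ∑ j, (p j * p j / N : ℝ)) atTop (𝓝 (∑ j : Fin n, 0)) :=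
      tendsto_finsetSum _ fun j _ => tendsto_const_div_atTop_nhds_zero_nat _
    simpa using h1.const_mul (f b)
  refine Tendsto.mono_left ?_ Nat.hyperfilter_le_atTop
  rw [tendsto_iff_norm_sub_tendsto_zero]
  refine squeeze_zero' (Eventually.of_forall fun _ => norm_nonneg _) ?_ hlim
  filter_upwards [eventually_ge_atTop (∑ j, p j)] with N hN
  exact abs_integral_bernsteinMeasure_sub_le hf hb hh p fun j =>
    (Finset.single_le_sum (fun _ _ => Nat.zero_le _) (Finset.mem_univ j)).trans hN

end Moments

/-! ### The multidimensional Bernstein theorem -/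

section Bernstein

variable {n : ℕ} {f : (Fin n → ℝ) → ℝ}

theorem continuous_exp_sum (s : Fin n → ℝ) :
    Continuous fun u : Fin n → ℝ≥0 => Real.exp (∑ j, s j * (u j : ℝ)) := by
  fun_prop

theorem continuous_prod_rpow {q : Fin n → ℝ} (hq : ∀ j, 0 < q j) :
    Continuous fun y : Fin n → unitInterval => ∏ j, (y j : ℝ) ^ q j :=
  continuous_finsetProd _ fun j _ =>
    (continuous_subtype_val.comp (continuous_apply j)).rpow_const fun _ => Or.inr (hq j).le

theorem integrable_of_continuous (ν : Measure (Fin n → unitInterval)) [IsFiniteMeasure ν]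
    {g : (Fin n → unitInterval) → ℝ} (hg : Continuous g) : Integrable g ν :=
  hg.integrable_of_hasCompactSupport (HasCompactSupport.of_compactSpace g)

/-- A bounded absolutely monotone function has, after the substitution `y_j = exp (-u_j)`, an
integral representation by a measure on the cube. The measure is a weak limit of measures that
represent `f` on the lattices of mesh `1 / (m + 1)`; by monotonicity of `f` the lattice values
determine the limit at every point. -/
theorem exists_measure_prod_rpow (hf : IsAbsolutelyMonotone f) {K : ℝ}
    (hK : ∀ s ∈ negOrthant n, f s ≤ K) :
    ∃ ν : FiniteMeasure (Fin n → unitInterval), ∀ q : Fin n → ℝ, (∀ j, 0 < q j) →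
      ∫ y, ∏ j, (y j : ℝ) ^ q j ∂(ν : Measure (Fin n → unitInterval)) = f (-q) := by
  set h : ℕ → ℝ := fun m => 1 / (m + 1) with hh
  have hpos : ∀ m, 0 < h m := fun m => by positivity
  have hb : ∀ m, (fun _ => -h m) ∈ negOrthant n := fun m j => neg_neg_of_pos (hpos m)
  choose μ hμ using fun m => exists_measure_moments hf (hb m) (hpos m).le
  set pw : ℕ → (Fin n → unitInterval) → (Fin n → unitInterval) :=
    fun m y j => y j ^ (m + 1) with hpw
  have hpwc : ∀ m, Continuous (pw m) := fun m => by fun_prop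
  have hmass : ∀ m, ((μ m).map (pw m)).mass ≤ K.toNNReal := by
    intro m
    have h1 := hμ m 0
    simp only [Pi.zero_apply, pow_zero, Finset.prod_const_one, integral_const, smul_eq_mul,
      mul_one, Nat.cast_zero, mul_zero, sub_zero] at h1
    have h2 : ((μ m).map (pw m)).mass = (μ m).mass := by
      simp only [FiniteMeasure.mass]
      rw [FiniteMeasure.map_apply _ (hpwc m).measurable MeasurableSet.univ, Set.preimage_univ]
    rw [h2]
    refine NNReal.le_toNNReal_of_coe_le ?_
    refine le_trans (le_of_eq ?_) (hK _ (hb m))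
    rw [← h1]
    rfl
  obtain ⟨ν, hν⟩ := exists_tendsto_integral_hyperfilter _ _ hmass
  refine ⟨ν, fun q hq => tendsto_nhds_unique (hν _ (continuous_prod_rpow hq)) ?_⟩
  have hint : ∀ m, ∫ y, ∏ j, (y j : ℝ) ^ q j
      ∂((μ m).map (pw m) : Measure (Fin n → unitInterval)) =
      ∫ y, ∏ j, (y j : ℝ) ^ (((m + 1 : ℕ) : ℝ) * q j)
        ∂(μ m : Measure (Fin n → unitInterval)) := by
    intro m
    rw [FiniteMeasure.toMeasure_map, integral_map (hpwc m).aemeasurable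
      (continuous_prod_rpow hq).aestronglyMeasurable]
    refine integral_congr_ae (Eventually.of_forall fun y => ?_)
    refine Finset.prod_congr rfl fun j _ => ?_
    rw [hpw, Real.rpow_natCast_mul (y j).2.1]
    rfl
  simp only [hint]
  -- The exponents `(m + 1) q_j` are squeezed between consecutive integers.
  set p : ℕ → Fin n → ℕ := fun m j => ⌊q j * ((m + 1 : ℕ) : ℝ)⌋₊ with hp
  have hq' : -q ∈ negOrthant n := fun j => neg_neg_of_pos (hq j)
  have hcast : Tendsto (fun m : ℕ => ((m + 1 : ℕ) : ℝ)) atTop atTop :=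
    tendsto_natCast_atTop_atTop.comp (tendsto_add_atTop_nat 1)
  have hh0 : Tendsto h atTop (𝓝 0) := tendsto_one_div_add_atTop_nhds_zero_nat
  have hhp : ∀ j, Tendsto (fun m => h m * p m j) atTop (𝓝 (q j)) := by
    intro j
    have := (tendsto_nat_floor_mul_div_atTop (R := ℝ) (hq j).le).comp hcast
    refine this.congr fun m => ?_
    simp [hp, hh]
    ring
  have hcont : ContinuousAt f (-q) := (hf.differentiableAt hq').continuousAt
  have hupper : Tendsto (fun m => f fun j => -h m - h m * p m j) atTop (𝓝 (f (-q))) := by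
    refine hcont.tendsto.comp (tendsto_pi_nhds.2 fun j => ?_)
    have := hh0.neg.sub (hhp j)
    rwa [neg_zero, zero_sub] at this
  have hlower : Tendsto (fun m => f fun j => -h m - h m * (p m j + 1 : ℕ)) atTop
      (𝓝 (f (-q))) := by
    refine hcont.tendsto.comp (tendsto_pi_nhds.2 fun j => ?_)
    have := (hh0.neg.sub (hhp j)).sub hh0
    rw [neg_zero, zero_sub, sub_zero] at this
    refine this.congr fun m => ?_
    push_cast
    ring
  refine Tendsto.mono_left ?_ Nat.hyperfilter_le_atTop
  have hexp : ∀ m j, 0 < ((m + 1 : ℕ) : ℝ) * q j := fun m j => by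
    have := hq j
    positivity
  refine tendsto_of_tendsto_of_tendsto_of_le_of_le hlower hupper (fun m => ?_) fun m => ?_
  · dsimp only
    rw [← hμ m fun j => p m j + 1]
    refine integral_mono (integrable_of_continuous _ (by fun_prop))
      (integrable_of_continuous _ (continuous_prod_rpow (hexp m))) fun y => ?_
    refine Finset.prod_le_prod (fun j _ => pow_nonneg (y j).2.1 _) fun j _ => ?_
    rw [← Real.rpow_natCast]
    refine Real.rpow_le_rpow_of_exponent_ge' (y j).2.1 (y j).2.2 (hexp m j).le ?_
    push_cast
    rw [mul_comm]
    exact_mod_cast (Nat.lt_floor_add_one (q j * ((m + 1 : ℕ) : ℝ))).le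
  · dsimp only
    rw [← hμ m (p m)]
    refine integral_mono (integrable_of_continuous _ (continuous_prod_rpow (hexp m)))
      (integrable_of_continuous _ (by fun_prop)) fun y => ?_
    refine Finset.prod_le_prod (fun j _ => Real.rpow_nonneg (y j).2.1 _) fun j _ => ?_
    rw [← Real.rpow_natCast]
    refine Real.rpow_le_rpow_of_exponent_ge' (y j).2.1 (y j).2.2 (Nat.cast_nonneg _) ?_
    rw [mul_comm]
    exact Nat.floor_le (by have := hq j; positivity)

/-- **Bernstein's theorem** in several variables: a bounded absolutely monotone function on
`(-∞, 0)^n` is the Laplace transform of a finite measure on `ℝ_+^n`. -/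
theorem exists_hasLaplaceTransform (hf : IsAbsolutelyMonotone f) {K : ℝ}
    (hK : ∀ s ∈ negOrthant n, f s ≤ K) :
    ∃ ν : FiniteMeasure (Fin n → ℝ≥0), HasLaplaceTransform ν f := by
  obtain ⟨ν, hν⟩ := exists_measure_prod_rpow hf hK
  set P : Set (Fin n → unitInterval) := {y | ∀ j, (0 : ℝ) < y j} with hP
  have hPm : MeasurableSet P := by
    rw [hP, Set.ofPred_forall]
    exact MeasurableSet.iInter fun j => measurableSet_lt measurable_const
      (measurable_subtype_coe.comp (measurable_pi_apply j))
  set lg : (Fin n → unitInterval) → (Fin n → ℝ≥0) :=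
    fun y j => (-Real.log (y j)).toNNReal with hlg
  have hlgm : Measurable lg := measurable_pi_lambda _ fun j =>
    ((Real.measurable_log.comp
      (measurable_subtype_coe.comp (measurable_pi_apply j))).neg).real_toNNReal
  -- The part of `ν` on the faces `y_j = 0` corresponds to `u_j = ∞` and does not contribute.
  refine ⟨⟨((ν : Measure (Fin n → unitInterval)).restrict P).map lg, inferInstance⟩,
    fun s hs => ?_⟩
  have hq : ∀ j, 0 < (-s) j := fun j => neg_pos_of_neg (hs j)
  have h1 := hν (-s) hq
  rw [neg_neg] at h1
  have hset : ∫ y in P, ∏ j, (y j : ℝ) ^ (-s) j ∂(ν : Measure (Fin n → unitInterval)) =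
      ∫ y, ∏ j, (y j : ℝ) ^ (-s) j ∂(ν : Measure (Fin n → unitInterval)) := by
    refine setIntegral_eq_integral_of_forall_compl_eq_zero fun y hy => ?_
    simp only [hP, Set.mem_ofPred_eq, not_forall, not_lt] at hy
    obtain ⟨j, hj⟩ := hy
    refine Finset.prod_eq_zero (Finset.mem_univ j) ?_
    rw [le_antisymm hj (y j).2.1, Real.zero_rpow (hq j).ne']
  rw [← h1, ← hset, FiniteMeasure.toMeasure_mk,
    integral_map hlgm.aemeasurable (continuous_exp_sum s).aestronglyMeasurable]
  refine setIntegral_congr_fun hPm fun y hy => ?_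
  rw [Real.exp_sum]
  refine Finset.prod_congr rfl fun j _ => ?_
  have h2 : 0 ≤ -Real.log (y j) := neg_nonneg.2 (Real.log_nonpos (y j).2.1 (y j).2.2)
  rw [hlg, Real.coe_toNNReal _ h2, Real.rpow_def_of_pos (hy j)]
  congr 1
  simp only [Pi.neg_apply]
  ring

end Bernstein

/-! ### Uniqueness of the Laplace transform -/

section Uniqueness

variable {n : ℕ}

theorem sum_mul_coe_nonpos {s : Fin n → ℝ} (hs : s ≤ 0) (u : Fin n → ℝ≥0) :
    ∑ j, s j * (u j : ℝ) ≤ 0 :=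
  Finset.sum_nonpos fun j _ => mul_nonpos_of_nonpos_of_nonneg (hs j) (u j).2

/-- The Laplace kernel `u ↦ exp (s · u)`, `s ≤ 0`, as a bounded continuous function. -/
def laplaceKernel (s : Fin n → ℝ) (hs : s ≤ 0) : (Fin n → ℝ≥0) →ᵇ ℝ :=
  BoundedContinuousFunction.ofNormedAddCommGroup (fun u => Real.exp (∑ j, s j * (u j : ℝ)))
    (by fun_prop) 1 fun u => by
      rw [Real.norm_of_nonneg (Real.exp_pos _).le]
      exact Real.exp_le_one_iff.2 (sum_mul_coe_nonpos hs u)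

/-- The multiplicative monoid of the Laplace kernels. -/
def laplaceKernels (n : ℕ) : Submonoid ((Fin n → ℝ≥0) →ᵇ ℝ) where
  carrier := {φ | ∃ s hs, φ = laplaceKernel s hs}
  one_mem' := ⟨0, le_rfl, by ext u; simp [laplaceKernel]⟩
  mul_mem' := by
    rintro _ _ ⟨s, hs, rfl⟩ ⟨t, ht, rfl⟩
    refine ⟨s + t, add_nonpos hs ht, ?_⟩
    ext u
    simp [laplaceKernel, ← Real.exp_add, add_mul, Finset.sum_add_distrib]

/-- Laplace integrals at `s ≤ 0` are limits of Laplace integrals in the open orthant. -/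
theorem tendsto_integral_exp (ν : Measure (Fin n → ℝ≥0)) [IsFiniteMeasure ν] {s : Fin n → ℝ}
    (hs : s ≤ 0) :
    Tendsto (fun k : ℕ => ∫ u, Real.exp (∑ j, (s j - 1 / ((k : ℝ) + 1)) * (u j : ℝ)) ∂ν) atTop
      (𝓝 (∫ u, Real.exp (∑ j, s j * (u j : ℝ)) ∂ν)) := by
  refine tendsto_integral_of_dominated_convergence (fun _ => 1)
    (fun k => (continuous_exp_sum _).aestronglyMeasurable) (integrable_const 1)
    (fun k => Eventually.of_forall fun u => ?_)
    (Eventually.of_forall fun u => ?_)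
  · rw [Real.norm_of_nonneg (Real.exp_pos _).le]
    refine Real.exp_le_one_iff.2 (sum_mul_coe_nonpos (s := fun j => s j - 1 / ((k : ℝ) + 1))
      (fun j => ?_) u)
    have h1 : (0 : ℝ) ≤ 1 / ((k : ℝ) + 1) := by positivity
    have h2 := hs j
    simp only [Pi.zero_apply] at *
    linarith
  · refine (Real.continuous_exp.tendsto _).comp (tendsto_finsetSum _ fun j _ => ?_)
    have := (tendsto_one_div_add_atTop_nhds_zero_nat (𝕜 := ℝ)).const_sub (s j)
    rw [sub_zero] at this
    exact this.mul_const _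

theorem sub_one_div_mem_negOrthant {s : Fin n → ℝ} (hs : s ≤ 0) (k : ℕ) :
    (fun j => s j - 1 / ((k : ℝ) + 1)) ∈ negOrthant n := fun j => by
  have h1 : (0 : ℝ) < 1 / ((k : ℝ) + 1) := by positivity
  have h2 := hs j
  simp only [Pi.zero_apply] at *
  linarith

/-- The Laplace transform determines the measure: the kernels span an algebra of bounded continuous
functions that separates points. -/
theorem HasLaplaceTransform.unique {ν ν' : FiniteMeasure (Fin n → ℝ≥0)} {g : (Fin n → ℝ) → ℝ}
    (h : HasLaplaceTransform ν g) (h' : HasLaplaceTransform ν' g) : ν = ν' := by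
  have hker : ∀ s : Fin n → ℝ, s ≤ 0 →
      ∫ u, Real.exp (∑ j, s j * (u j : ℝ)) ∂(ν : Measure (Fin n → ℝ≥0)) =
        ∫ u, Real.exp (∑ j, s j * (u j : ℝ)) ∂(ν' : Measure (Fin n → ℝ≥0)) := by
    intro s hs
    refine tendsto_nhds_unique (tendsto_integral_exp _ hs)
      ((tendsto_integral_exp (ν' : Measure (Fin n → ℝ≥0)) hs).congr fun k => ?_)
    rw [h _ (sub_one_div_mem_negOrthant hs k), h' _ (sub_one_div_mem_negOrthant hs k)]
  let A : StarSubalgebra ℝ ((Fin n → ℝ≥0) →ᵇ ℝ) :=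
    { Algebra.adjoin ℝ (laplaceKernels n : Set ((Fin n → ℝ≥0) →ᵇ ℝ)) with
      star_mem' := fun {φ} hφ => by
        have : star φ = φ := by
          ext u
          simp
        rw [this]
        exact hφ }
  have hA : ∀ φ, φ ∈ A ↔
      φ ∈ Submodule.span ℝ (laplaceKernels n : Set ((Fin n → ℝ≥0) →ᵇ ℝ)) := by
    intro φ
    have := Algebra.adjoin_eq_span ℝ (laplaceKernels n : Set ((Fin n → ℝ≥0) →ᵇ ℝ))
    rw [Submonoid.closure_eq] at this
    rw [← this]
    rfl
  apply FiniteMeasure.toMeasure_injective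
  refine ext_of_forall_mem_subalgebra_integral_eq_of_pseudoEMetric_complete_countable (𝕜 := ℝ)
    (A := A) ?_ ?_
  · intro u u' huu'
    obtain ⟨j, hj⟩ := Function.ne_iff.1 huu'
    have hs : (-Pi.single j 1 : Fin n → ℝ) ≤ 0 :=
      neg_nonpos.2 (Pi.single_nonneg.2 zero_le_one)
    refine ⟨_, ⟨_, ⟨laplaceKernel _ hs, (hA _).2 (Submodule.subset_span ⟨_, hs, rfl⟩), rfl⟩, rfl⟩,
      ?_⟩
    have hval : ∀ w : Fin n → ℝ≥0, laplaceKernel _ hs w = Real.exp (-(w j : ℝ)) := by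
      intro w
      simp [laplaceKernel, Pi.single_apply]
    change laplaceKernel _ hs u ≠ laplaceKernel _ hs u'
    rw [hval, hval]
    intro he
    exact hj (NNReal.eq (neg_injective (Real.exp_injective he)))
  · intro φ hφ
    rw [hA] at hφ
    induction hφ using Submodule.span_induction with
    | mem φ hφ =>
      obtain ⟨s, hs, rfl⟩ := hφ
      exact hker s hs
    | zero => simp
    | add φ χ _ _ ihφ ihχ =>
      simp only [BoundedContinuousFunction.coe_add, Pi.add_apply]
      rw [integral_add (φ.integrable _) (χ.integrable _),
        integral_add (φ.integrable _) (χ.integrable _), ihφ, ihχ]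
    | smul c φ _ ih =>
      simp only [BoundedContinuousFunction.coe_smul]
      rw [integral_smul, integral_smul, ih]

theorem HasLaplaceTransform.mass_le {ν : FiniteMeasure (Fin n → ℝ≥0)} {g : (Fin n → ℝ) → ℝ}
    (h : HasLaplaceTransform ν g) {K : ℝ} (hK : ∀ s ∈ negOrthant n, g s ≤ K) :
    (ν : Measure (Fin n → ℝ≥0)).real Set.univ ≤ K := by
  have h1 := tendsto_integral_exp (ν : Measure (Fin n → ℝ≥0)) (le_refl (0 : Fin n → ℝ))
  simp only [Pi.zero_apply, zero_mul, Finset.sum_const_zero, Real.exp_zero, integral_const,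
    smul_eq_mul, mul_one] at h1
  refine le_of_tendsto h1 (Eventually.of_forall fun k => ?_)
  have hs := sub_one_div_mem_negOrthant (le_refl (0 : Fin n → ℝ)) k
  exact (h _ hs).trans_le (hK _ hs)

end Uniqueness

/-! ### The measures `ν_t` -/

section SubMeasure

variable {n : ℕ} {ψ : (Fin n → ℝ) → ℝ}

theorem IsBernstein.exp_le_one (hψ : IsBernstein ψ) (t : ℝ≥0) {s : Fin n → ℝ}
    (hs : s ∈ negOrthant n) : Real.exp (t * ψ s) ≤ 1 :=
  Real.exp_le_one_iff.2 (mul_nonpos_of_nonneg_of_nonpos t.coe_nonneg (hψ.nonpos s hs))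

theorem IsBernstein.hasLaplaceTransform_subMeasure (hψ : IsBernstein ψ) (t : ℝ≥0) :
    HasLaplaceTransform (subMeasure ψ t) fun s => Real.exp ((t : ℝ) * ψ s) :=
  Classical.epsilon_spec (p := fun ν : FiniteMeasure (Fin n → ℝ≥0) =>
      HasLaplaceTransform ν fun s => Real.exp ((t : ℝ) * ψ s))
    (exists_hasLaplaceTransform (isAbsolutelyMonotone_exp hψ.smooth hψ.partials t.coe_nonneg)
      fun _ hs => hψ.exp_le_one t hs)

theorem IsBernstein.mass_subMeasure_le (hψ : IsBernstein ψ) (t : ℝ≥0) :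
    (subMeasure ψ t : Measure (Fin n → ℝ≥0)).real Set.univ ≤ 1 :=
  (hψ.hasLaplaceTransform_subMeasure t).mass_le fun _ hs => hψ.exp_le_one t hs

end SubMeasure

/-! ### Bounded Bernstein functions of generators -/

section BoundedBernstein

variable {X : Type*} [NormedAddCommGroup X] [NormedSpace ℂ X] {n : ℕ}

instance : (𝓝[>] (0 : ℝ≥0)).NeBot := nhdsGT_neBot 0

theorem generator_apply_eq {S : ℝ≥0 → X →L[ℂ] X} {x y : X}
    (h : Tendsto (fun t : ℝ≥0 => (t : ℝ)⁻¹ • (S t x - x)) (𝓝[>] 0) (𝓝 y))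
    (hx : x ∈ (generator S).domain) : generator S ⟨x, hx⟩ = y :=
  tendsto_nhds_unique (Exists.choose_spec hx) h

theorem tendsto_coe_nhdsGT : Tendsto (fun t : ℝ≥0 => (t : ℝ)) (𝓝[>] 0) (𝓝[≠] 0) := by
  refine tendsto_nhdsWithin_iff.2 ⟨?_, ?_⟩
  · exact (NNReal.continuous_coe.tendsto' 0 0 rfl).mono_left nhdsWithin_le_nhds
  · filter_upwards [self_mem_nhdsWithin] with t ht
    exact (NNReal.coe_pos.2 ht).ne'

theorem tendsto_inv_mul_exp_sub_one (c : ℝ) :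
    Tendsto (fun t : ℝ≥0 => (t : ℝ)⁻¹ * (Real.exp (t * c) - 1)) (𝓝[>] 0) (𝓝 c) := by
  have h1 : HasDerivAt (fun t : ℝ => Real.exp (t * c)) c 0 := by
    simpa using ((hasDerivAt_id (0 : ℝ)).mul_const c).exp
  have h2 := (hasDerivAt_iff_tendsto_slope_zero.1 h1).comp tendsto_coe_nhdsGT
  simpa [Function.comp_def] using h2

theorem tendsto_exp_mul_nhdsGT (c : ℝ) :
    Tendsto (fun t : ℝ≥0 => Real.exp (t * c)) (𝓝[>] 0) (𝓝 1) := by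
  have : Continuous fun t : ℝ≥0 => Real.exp (t * c) := by fun_prop
  exact (this.tendsto' 0 1 (by simp)).mono_left nhdsWithin_le_nhds

namespace MultiSemigroup

variable (T : MultiSemigroup n X)

theorem norm_op_le {M : ℝ} (hM1 : 1 ≤ M) (hM : ∀ j t, ‖(T.part j).op t‖ ≤ M)
    (u : Fin n → ℝ≥0) : ‖T.op u‖ ≤ M ^ n := by
  have h : ∀ l : List (Fin n),
      ‖(l.map fun j => (T.part j).op (u j)).prod‖ ≤ M ^ l.length := by
    intro l
    induction l with
    | nil =>
      rw [List.map_nil, List.prod_nil, List.length_nil, pow_zero]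
      exact ContinuousLinearMap.norm_id_le
    | cons j l ih =>
      rw [List.map_cons, List.prod_cons, List.length_cons, pow_succ']
      exact (norm_mul_le _ _).trans
        (mul_le_mul (hM _ _) ih (norm_nonneg _) (zero_le_one.trans hM1))
  have := h (List.finRange n)
  rwa [List.length_finRange, ← List.ofFn_eq_map] at this

theorem op_zero : T.op 0 = 1 := by
  rw [op]
  have h : ∀ j, (T.part j).op ((0 : Fin n → ℝ≥0) j) = 1 := fun j => (T.part j).op_zero
  simp only [h]
  exact List.prod_eq_one fun x hx => by
    obtain ⟨j, rfl⟩ := (List.mem_ofFn' _ _).1 hx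
    rfl

theorem integralOp_apply (ν : FiniteMeasure (Fin n → ℝ≥0)) (x : X) :
    T.integralOp ν x = ∫ u, T.op u x ∂(ν : Measure (Fin n → ℝ≥0)) := rfl

theorem norm_integralOp_apply_le {M : ℝ} (hM : ∀ u, ‖T.op u‖ ≤ M)
    (ν : FiniteMeasure (Fin n → ℝ≥0)) (x : X) :
    ‖T.integralOp ν x‖ ≤ M * ‖x‖ * (ν : Measure (Fin n → ℝ≥0)).real Set.univ :=
  norm_integral_le_of_norm_le_const
    (Eventually.of_forall fun u => (T.op u).le_of_opNorm_le (hM u) x)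

end MultiSemigroup

/-- The unit mass at the origin. -/
def diracZero (n : ℕ) : FiniteMeasure (Fin n → ℝ≥0) := ⟨Measure.dirac 0, inferInstance⟩

theorem integral_smul_add_add {E : Type*} [NormedAddCommGroup E] [NormedSpace ℝ E]
    [CompleteSpace E]
    (c t : ℝ≥0) (μ ρ : FiniteMeasure (Fin n → ℝ≥0)) (F : (Fin n → ℝ≥0) → E)
    (hF : ∀ ν : FiniteMeasure (Fin n → ℝ≥0), Integrable F (ν : Measure (Fin n → ℝ≥0))) :
    ∫ u, F u ∂((c • (diracZero n + t • μ + ρ) : FiniteMeasure (Fin n → ℝ≥0)) :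
      Measure (Fin n → ℝ≥0)) =
      (c : ℝ) • (F 0 + (t : ℝ) • ∫ u, F u ∂(μ : Measure (Fin n → ℝ≥0)) +
        ∫ u, F u ∂(ρ : Measure (Fin n → ℝ≥0))) := by
  rw [FiniteMeasure.toMeasure_smul, integral_smul_nnreal_measure, FiniteMeasure.toMeasure_add,
    integral_add_measure (hF _) (hF _), FiniteMeasure.toMeasure_add,
    integral_add_measure (hF _) (hF _), FiniteMeasure.toMeasure_smul,
    integral_smul_nnreal_measure, diracZero, FiniteMeasure.toMeasure_mk, integral_dirac]
  rfl

/-- If `ψ + K` is nonnegative with representing measure `μ`, then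
`ν_t = exp (-t K) (δ_0 + t μ + ρ_t)` with `ρ_t` of mass `O(t ^ 2)`. -/
theorem exists_subMeasure_expansion {ψ : (Fin n → ℝ) → ℝ} (hψ : IsBernstein ψ) {K : ℝ}
    (hK : ∀ s ∈ negOrthant n, |ψ s| ≤ K) :
    ∃ μ : FiniteMeasure (Fin n → ℝ≥0), (μ : Measure (Fin n → ℝ≥0)).real Set.univ ≤ K ∧
      ∀ t : ℝ≥0, ∃ ρ : FiniteMeasure (Fin n → ℝ≥0),
        (ρ : Measure (Fin n → ℝ≥0)).real Set.univ ≤ Real.exp (t * K) - 1 - t * K ∧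
        subMeasure ψ t = (Real.exp (t * -K)).toNNReal • (diracZero n + t • μ + ρ) := by
  set φ : (Fin n → ℝ) → ℝ := fun s => ψ s + K with hφdef
  have hφ0 : ∀ s ∈ negOrthant n, 0 ≤ φ s := fun s hs => by
    have := (abs_le.1 (hK s hs)).1
    simp only [hφdef]
    linarith
  have hφK : ∀ s ∈ negOrthant n, φ s ≤ K := fun s hs => by
    have := hψ.nonpos s hs
    simp only [hφdef]
    linarith
  have hφ : IsAbsolutelyMonotone φ := by
    refine .of_partials (hψ.smooth.add contDiffOn_const) hφ0 fun j =>
      ⟨_, hψ.partials j, fun s _ => ?_⟩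
    simp only [partialDeriv, hφdef, fderiv_add_const]
  obtain ⟨μ, hμ⟩ := exists_hasLaplaceTransform hφ hφK
  refine ⟨μ, hμ.mass_le hφK, fun t => ?_⟩
  have hbound : ∀ s ∈ negOrthant n,
      Real.exp (t * φ s) - 1 - t * φ s ≤ Real.exp (t * K) - 1 - t * K := by
    intro s hs
    have h0 : 0 ≤ t * φ s := mul_nonneg t.coe_nonneg (hφ0 s hs)
    have h1 : t * φ s ≤ t * K := mul_le_mul_of_nonneg_left (hφK s hs) t.coe_nonneg
    have h2 : Real.exp (t * K) = Real.exp (t * φ s) * Real.exp (t * K - t * φ s) := by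
      rw [← Real.exp_add]
      ring_nf
    have h3 := Real.add_one_le_exp (t * K - t * φ s)
    have h4 := Real.one_le_exp h0
    nlinarith
  obtain ⟨ρ, hρ⟩ := exists_hasLaplaceTransform (hφ.exp_sub_one_sub t.coe_nonneg) hbound
  refine ⟨ρ, hρ.mass_le hbound, (hψ.hasLaplaceTransform_subMeasure t).unique fun s hs => ?_⟩
  have hint : ∀ ν : FiniteMeasure (Fin n → ℝ≥0),
      Integrable (fun u : Fin n → ℝ≥0 => Real.exp (∑ j, s j * (u j : ℝ)))
        (ν : Measure (Fin n → ℝ≥0)) := fun ν =>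
    (laplaceKernel s fun j => (hs j).le).integrable _
  rw [integral_smul_add_add _ _ _ _ _ hint, hμ s hs, hρ s hs,
    Real.coe_toNNReal _ (Real.exp_pos _).le]
  simp only [Pi.zero_apply, NNReal.coe_zero, mul_zero, Finset.sum_const_zero, Real.exp_zero,
    smul_eq_mul]
  rw [show (1 : ℝ) + t * φ s + (Real.exp (t * φ s) - 1 - t * φ s) = Real.exp (t * φ s) by ring,
    ← Real.exp_add]
  congr 1
  simp only [hφdef]
  ring

/-- For bounded `ψ` the operator `ψ(A)` is everywhere defined: `ψ(A) x = ∫ T(u) x dμ(u) - K x`,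
where `μ` represents `ψ + K`. -/
theorem exists_bochnerPhillips_bound {ψ : (Fin n → ℝ) → ℝ} (hψ : IsBernstein ψ)
    (hb : BoundedOnNegOrthant ψ) :
    ∃ C : ℝ → ℝ, ∀ (X : Type u) [NormedAddCommGroup X] [NormedSpace ℂ X] [CompleteSpace X]
      (T : MultiSemigroup n X) (M : ℝ), 1 ≤ M → (∀ j t, ‖(T.part j).op t‖ ≤ M) →
        (T.bochnerPhillips ψ).domain = ⊤ ∧
        ∀ x : (T.bochnerPhillips ψ).domain, ‖T.bochnerPhillips ψ x‖ ≤ C M * ‖(x : X)‖ := by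
  obtain ⟨K, hK⟩ := hb
  have hK0 : 0 ≤ K := (abs_nonneg _).trans (hK (fun _ => -1) fun _ => by norm_num)
  obtain ⟨μ, hμ, hexp⟩ := exists_subMeasure_expansion hψ hK
  choose ρ hρ hν using hexp
  refine ⟨fun M => K + M ^ n * K, fun X _ _ _ T M hM1 hM => ?_⟩
  have hMn : 0 ≤ M ^ n := by positivity
  have hop := T.norm_op_le hM1 hM
  have hlim : ∀ x : X, Tendsto (fun t : ℝ≥0 => (t : ℝ)⁻¹ • (T.subordinate ψ t x - x)) (𝓝[>] 0)
      (𝓝 (-K • x + T.integralOp μ x)) := by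
    intro x
    have hrem : Tendsto (fun t : ℝ≥0 => (t : ℝ)⁻¹ • T.integralOp (ρ t) x) (𝓝[>] 0) (𝓝 0) := by
      have h1 : Tendsto (fun t : ℝ≥0 => M ^ n * ‖x‖ *
          ((t : ℝ)⁻¹ * (Real.exp (t * K) - 1) - K)) (𝓝[>] 0) (𝓝 0) := by
        simpa using ((tendsto_inv_mul_exp_sub_one K).sub_const K).const_mul (M ^ n * ‖x‖)
      refine squeeze_zero_norm' ?_ h1
      filter_upwards [self_mem_nhdsWithin] with t ht
      have ht' : (0 : ℝ) < t := NNReal.coe_pos.2 ht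
      rw [norm_smul, Real.norm_of_nonneg (inv_nonneg.2 ht'.le)]
      have h2 := (T.norm_integralOp_apply_le hop (ρ t) x).trans
        (mul_le_mul_of_nonneg_left (hρ t) (by positivity))
      refine (mul_le_mul_of_nonneg_left h2 (inv_nonneg.2 ht'.le)).trans (le_of_eq ?_)
      field_simp
    have h1 := ((tendsto_inv_mul_exp_sub_one (-K)).smul_const x).add
      ((tendsto_exp_mul_nhdsGT (-K)).smul ((tendsto_const_nhds (x := T.integralOp μ x)).add hrem))
    rw [one_smul, add_zero] at h1
    refine h1.congr' ?_
    filter_upwards [self_mem_nhdsWithin] with t ht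
    have ht' : (t : ℝ) ≠ 0 := (NNReal.coe_pos.2 ht).ne'
    have h2 : T.subordinate ψ t x = Real.exp (t * -K) •
        (x + (t : ℝ) • T.integralOp μ x + T.integralOp (ρ t) x) := by
      rw [MultiSemigroup.subordinate, T.integralOp_apply, hν t,
        integral_smul_add_add _ _ _ _ _ fun ν => T.integrable_op ν x, T.op_zero,
        Real.coe_toNNReal _ (Real.exp_pos _).le]
      rfl
    rw [h2]
    simp only [smul_add, smul_sub, smul_smul, mul_sub, sub_smul, mul_one]
    rw [mul_left_comm, inv_mul_cancel₀ ht', mul_one, mul_comm (Real.exp _) ((t : ℝ)⁻¹)]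
    abel
  have hdom : ∀ x, x ∈ (T.bochnerPhillips ψ).domain := fun x => ⟨_, hlim x⟩
  refine ⟨eq_top_iff.2 fun x _ => hdom x, fun x => ?_⟩
  have h1 : T.bochnerPhillips ψ x = -K • (x : X) + T.integralOp μ x :=
    generator_apply_eq (hlim x) x.2
  rw [h1]
  refine (norm_add_le _ _).trans ?_
  rw [norm_smul, norm_neg, Real.norm_of_nonneg hK0, add_mul]
  refine add_le_add le_rfl ((T.norm_integralOp_apply_le hop μ x).trans ?_)
  rw [mul_right_comm]
  gcongr

end BoundedBernstein

/-! ### The subordinated semigroup -/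

section Subordination

variable {X : Type*} [NormedAddCommGroup X] [NormedSpace ℂ X] {n : ℕ}

namespace MultiSemigroup

theorem op_add (T : MultiSemigroup n X) (u v : Fin n → ℝ≥0) :
    T.op (u + v) = T.op u * T.op v := by
  have h : ∀ l : List (Fin n), (l.map fun j => (T.part j).op ((u + v) j)).prod =
      (l.map fun j => (T.part j).op (u j)).prod * (l.map fun j => (T.part j).op (v j)).prod := by
    intro l
    induction l with
    | nil => simp
    | cons j l ih =>
      have hc : Commute ((T.part j).op (v j)) (l.map fun j => (T.part j).op (u j)).prod := by
        refine Commute.list_prod_right _ _ fun y hy => ?_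
        obtain ⟨i, -, rfl⟩ := List.mem_map.1 hy
        exact T.commute _ _ _ _
      simp only [List.map_cons, List.prod_cons]
      rw [ih, Pi.add_apply, (T.part j).op_add, mul_assoc, mul_assoc,
        ← mul_assoc ((T.part j).op (v j)), hc.eq, mul_assoc]
  simpa only [op, List.ofFn_eq_map] using h (List.finRange n)

variable [CompleteSpace X] (T : MultiSemigroup n X) {ψ : (Fin n → ℝ) → ℝ}

theorem subordinate_zero (hψ : IsBernstein ψ) : T.subordinate ψ 0 = 1 := by
  have h1 : subMeasure ψ 0 = diracZero n :=
    (hψ.hasLaplaceTransform_subMeasure 0).unique fun s _ => by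
      simp [diracZero]
  ext x
  rw [subordinate, h1, integralOp_apply, diracZero, FiniteMeasure.toMeasure_mk, integral_dirac,
    T.op_zero]

theorem subMeasure_add (hψ : IsBernstein ψ) (s t : ℝ≥0) :
    (subMeasure ψ (s + t) : Measure (Fin n → ℝ≥0)) =
      (subMeasure ψ s : Measure (Fin n → ℝ≥0)).conv (subMeasure ψ t : Measure (Fin n → ℝ≥0)) := by
  have h1 : subMeasure ψ (s + t) = (⟨(subMeasure ψ s : Measure (Fin n → ℝ≥0)).conv
      (subMeasure ψ t : Measure (Fin n → ℝ≥0)), inferInstance⟩ :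
      FiniteMeasure (Fin n → ℝ≥0)) := by
    refine (hψ.hasLaplaceTransform_subMeasure (s + t)).unique fun r hr => ?_
    have hint : Integrable (fun u : Fin n → ℝ≥0 => Real.exp (∑ j, r j * (u j : ℝ)))
        ((subMeasure ψ s : Measure (Fin n → ℝ≥0)).conv (subMeasure ψ t)) :=
      (laplaceKernel r fun j => (hr j).le).integrable _
    rw [FiniteMeasure.toMeasure_mk, integral_conv hint]
    have h2 : ∀ u v : Fin n → ℝ≥0, Real.exp (∑ j, r j * ((u + v) j : ℝ)) =
        Real.exp (∑ j, r j * (u j : ℝ)) * Real.exp (∑ j, r j * (v j : ℝ)) := by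
      intro u v
      rw [← Real.exp_add, ← Finset.sum_add_distrib]
      simp [mul_add]
    simp only [h2, integral_const_mul, integral_mul_const]
    rw [hψ.hasLaplaceTransform_subMeasure s r hr, hψ.hasLaplaceTransform_subMeasure t r hr,
      ← Real.exp_add]
    push_cast
    ring_nf
  rw [h1]
  rfl

theorem subordinate_add (hψ : IsBernstein ψ) (s t : ℝ≥0) :
    T.subordinate ψ (s + t) = T.subordinate ψ s * T.subordinate ψ t := by
  ext x
  have hint := T.integrable_op (subMeasure ψ (s + t)) x
  rw [subMeasure_add hψ] at hint
  rw [subordinate, integralOp_apply, subMeasure_add hψ, integral_conv hint,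
    mul_apply_eq_comp, subordinate, integralOp_apply]
  refine integral_congr_ae (Eventually.of_forall fun u => ?_)
  dsimp only
  rw [subordinate, integralOp_apply, ← ContinuousLinearMap.integral_comp_comm _
    (T.integrable_op _ x)]
  simp only [T.op_add]
  rfl

end MultiSemigroup

/-- The measures `ν_t` converge to the unit mass at the origin: `1 - exp (-∑ u_j)` has
`ν_t`-integral at most `1 - exp (t ψ (-1, …, -1))`, which controls the mass away from the origin. -/
theorem tendsto_integral_subMeasure {E : Type*} [NormedAddCommGroup E] [NormedSpace ℝ E]
    [CompleteSpace E] {ψ : (Fin n → ℝ) → ℝ} (hψ : IsBernstein ψ) {F : (Fin n → ℝ≥0) → E}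
    (hF : Continuous F) {B : ℝ} (hB : ∀ u, ‖F u‖ ≤ B) :
    Tendsto (fun t => ∫ u, F u ∂(subMeasure ψ t : Measure (Fin n → ℝ≥0))) (𝓝 0) (𝓝 (F 0)) := by
  have hB0 : 0 ≤ B := (norm_nonneg _).trans (hB 0)
  have hone : (fun _ => -1 : Fin n → ℝ) ∈ negOrthant n := fun _ => by norm_num
  set ψ₁ := ψ fun _ => -1
  set ker : (Fin n → ℝ≥0) → ℝ := fun u => Real.exp (∑ j, (-1 : ℝ) * (u j : ℝ)) with hker
  have hker1 : ∀ u, ker u ≤ 1 := fun u =>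
    Real.exp_le_one_iff.2 (sum_mul_coe_nonpos (s := fun _ => (-1 : ℝ)) (fun j => (hone j).le) u)
  have hkerint : ∀ t, ∫ u, ker u ∂(subMeasure ψ t : Measure (Fin n → ℝ≥0)) =
      Real.exp (t * ψ₁) := fun t => hψ.hasLaplaceTransform_subMeasure t _ hone
  have hkeri : ∀ t, Integrable ker (subMeasure ψ t : Measure (Fin n → ℝ≥0)) := fun t =>
    (laplaceKernel _ fun j => (hone j).le).integrable _
  have hFi : ∀ t, Integrable F (subMeasure ψ t : Measure (Fin n → ℝ≥0)) := fun t =>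
    Integrable.of_bound hF.aestronglyMeasurable B (Eventually.of_forall hB)
  rw [Metric.tendsto_nhds]
  intro ε hε
  obtain ⟨δ, hδ, hδF⟩ := Metric.continuousAt_iff.1 hF.continuousAt (ε / 2) (half_pos hε)
  have hδ1 : 0 < 1 - Real.exp (-δ) := by
    have : Real.exp (-δ) < 1 := by simpa using hδ
    linarith
  set D := 2 * B / (1 - Real.exp (-δ)) with hD
  have hD0 : 0 ≤ D := by positivity
  have hpt : ∀ u, ‖F u - F 0‖ ≤ ε / 2 + D * (1 - ker u) := by
    intro u
    by_cases hu : dist u 0 < δ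
    · have h1 := (hδF hu).le
      rw [dist_eq_norm] at h1
      have := mul_nonneg hD0 (sub_nonneg.2 (hker1 u))
      linarith
    -- Away from the origin the kernel is at most `exp (-δ)`, and `D` compensates for this.
    · have h1 : ∃ j, δ ≤ u j := by
        by_contra! hcon
        refine hu ((dist_pi_lt_iff hδ).2 fun j => ?_)
        rw [NNReal.dist_eq]
        simpa using hcon j
      obtain ⟨j, hj⟩ := h1
      have h2 : ker u ≤ Real.exp (-δ) := by
        refine Real.exp_le_exp.2 ?_
        simp only [neg_one_mul, Finset.sum_neg_distrib]
        refine neg_le_neg (hj.trans ?_)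
        exact Finset.single_le_sum (f := fun j => (u j : ℝ)) (fun i _ => (u i).coe_nonneg)
          (Finset.mem_univ j)
      have h3 : ‖F u - F 0‖ ≤ 2 * B := by
        have := norm_sub_le (F u) (F 0)
        linarith [hB u, hB 0]
      have h4 : 2 * B = D * (1 - Real.exp (-δ)) := by
        rw [hD, div_mul_cancel₀ _ hδ1.ne']
      have h5 : D * (1 - Real.exp (-δ)) ≤ D * (1 - ker u) :=
        mul_le_mul_of_nonneg_left (by linarith) hD0
      linarith
  have hDi : ∀ t, Integrable (fun u => D * (1 - ker u))
      (subMeasure ψ t : Measure (Fin n → ℝ≥0)) := fun t =>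
    ((integrable_const (1 : ℝ)).sub (hkeri t)).const_mul D
  have hsmall : ∀ᶠ t : ℝ≥0 in 𝓝 0, (D + B) * (1 - Real.exp (t * ψ₁)) < ε / 2 := by
    have hc : Continuous fun t : ℝ≥0 => (D + B) * (1 - Real.exp (t * ψ₁)) := by fun_prop
    exact (hc.tendsto' 0 0 (by simp)).eventually_lt_const (half_pos hε)
  filter_upwards [hsmall] with t ht
  set ν := (subMeasure ψ t : Measure (Fin n → ℝ≥0))
  have hm1 : ν.real Set.univ ≤ 1 := hψ.mass_subMeasure_le t
  have hm2 : Real.exp (t * ψ₁) ≤ ν.real Set.univ := by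
    rw [← hkerint t]
    refine (integral_mono (hkeri t) (integrable_const 1) hker1).trans (le_of_eq ?_)
    simp [ν]
  have h1 : ‖∫ u, (F u - F 0) ∂ν‖ ≤ ε / 2 * ν.real Set.univ +
      D * (ν.real Set.univ - Real.exp (t * ψ₁)) := by
    refine (norm_integral_le_of_norm_le (g := fun u => ε / 2 + D * (1 - ker u)) ?_
      (Eventually.of_forall hpt)).trans (le_of_eq ?_)
    · exact (integrable_const _).add (hDi t)
    · rw [integral_add (integrable_const _) (hDi t),
        integral_const_mul, integral_sub (integrable_const _) (hkeri t), hkerint]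
      simp [ν, mul_comm]
  have h2 : ∫ u, F u ∂ν - F 0 = ∫ u, (F u - F 0) ∂ν - (1 - ν.real Set.univ) • F 0 := by
    rw [integral_sub (hFi t) (integrable_const _), integral_const, sub_smul, one_smul]
    abel
  rw [dist_eq_norm, h2]
  refine (norm_sub_le _ _).trans_lt ?_
  rw [norm_smul, Real.norm_of_nonneg (by linarith : 0 ≤ 1 - ν.real Set.univ)]
  have h3 : (1 - ν.real Set.univ) * ‖F 0‖ ≤ (1 - Real.exp (t * ψ₁)) * B :=
    mul_le_mul (by linarith) (hB 0) (norm_nonneg _) (by linarith)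
  have h4 : D * (ν.real Set.univ - Real.exp (t * ψ₁)) ≤ D * (1 - Real.exp (t * ψ₁)) :=
    mul_le_mul_of_nonneg_left (by linarith) hD0
  have h5 : ε / 2 * ν.real Set.univ ≤ ε / 2 := mul_le_of_le_one_right (half_pos hε).le hm1
  linarith

/-- The subordinated semigroup as a `C₀`-semigroup. -/
def MultiSemigroup.subordinateSemigroup [CompleteSpace X] (T : MultiSemigroup n X)
    {ψ : (Fin n → ℝ) → ℝ} (hψ : IsBernstein ψ) : C0Semigroup X where
  op := T.subordinate ψ
  op_zero := T.subordinate_zero hψ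
  op_add := T.subordinate_add hψ
  tendsto_zero x := by
    obtain ⟨M, hM⟩ := T.exists_bound
    have := tendsto_integral_subMeasure hψ (T.continuous_op x)
      fun u => (T.op u).le_of_opNorm_le (hM u) x
    rwa [T.op_zero] at this

theorem MultiSemigroup.exists_norm_subordinate_le [CompleteSpace X] (T : MultiSemigroup n X)
    {ψ : (Fin n → ℝ) → ℝ} (hψ : IsBernstein ψ) : ∃ M : ℝ, ∀ t, ‖T.subordinate ψ t‖ ≤ M := by
  obtain ⟨M, hM⟩ := T.exists_bound
  have hM0 : 0 ≤ M := (norm_nonneg _).trans (hM 0)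
  refine ⟨M, fun t => ContinuousLinearMap.opNorm_le_bound _ hM0 fun x => ?_⟩
  refine (T.norm_integralOp_apply_le hM _ x).trans ?_
  exact mul_le_of_le_one_right (by positivity) (hψ.mass_subMeasure_le t)

/-! ### Semigroups with bounded generator -/

theorem C0Semigroup.continuous_orbit (S : C0Semigroup X) {M : ℝ} (hM : ∀ t, ‖S.op t‖ ≤ M) (x : X) :
    Continuous fun t => S.op t x := by
  -- A bounded semigroup is a one-parameter instance of `MultiSemigroup`.
  let T : MultiSemigroup 1 X :=
    { part := fun _ => S
      commute := fun _ _ s t => by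
        rw [commute_iff_eq, ← S.op_add, ← S.op_add, add_comm]
      bounded := fun _ => ⟨M, hM⟩ }
  exact (T.continuous_part 0).comp (Continuous.prodMk_left x)

/-- The integral `∫_0^r S(σ) x dσ` lies in the domain of the generator, which maps it to
`S(r) x - x`. -/
theorem C0Semigroup.tendsto_integral_orbit [CompleteSpace X] (S : C0Semigroup X) {M : ℝ}
    (hM : ∀ t, ‖S.op t‖ ≤ M) (x : X) (r : ℝ≥0) :
    Tendsto (fun t : ℝ≥0 => (t : ℝ)⁻¹ • (S.op t (∫ σ in (0 : ℝ)..r, S.op σ.toNNReal x) -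
      ∫ σ in (0 : ℝ)..r, S.op σ.toNNReal x)) (𝓝[>] 0) (𝓝 (S.op r x - x)) := by
  set F : ℝ → X := fun σ => S.op σ.toNNReal x with hF
  have hFc : Continuous F := (S.continuous_orbit hM x).comp continuous_real_toNNReal
  have hFi : ∀ a b, IntervalIntegrable F volume a b := fun a b => hFc.intervalIntegrable a b
  have hG : ∀ b, HasDerivAt (fun b => ∫ σ in (0 : ℝ)..b, F σ) (F b) b := fun b =>
    intervalIntegral.integral_hasDerivAt_right (hFi 0 b)
      (hFc.stronglyMeasurableAtFilter _ _) hFc.continuousAt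
  have hlim : ∀ b, Tendsto (fun t : ℝ≥0 => (t : ℝ)⁻¹ •
      ((∫ σ in (0 : ℝ)..(b + t), F σ) - ∫ σ in (0 : ℝ)..b, F σ)) (𝓝[>] 0) (𝓝 (F b)) := fun b =>
    (hasDerivAt_iff_tendsto_slope_zero.1 (hG b)).comp tendsto_coe_nhdsGT
  have h0 := (hlim r).sub (hlim 0)
  have hFr : F r - F 0 = S.op r x - x := by
    simp [hF, S.op_zero]
  rw [hFr] at h0
  refine h0.congr fun t => ?_
  rw [← smul_sub]
  congr 1
  have h1 : S.op t (∫ σ in (0 : ℝ)..r, F σ) = ∫ σ in (t : ℝ)..(t + r), F σ := by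
    rw [← ContinuousLinearMap.intervalIntegral_comp_comm _ (hFi 0 r)]
    have h2 := intervalIntegral.integral_comp_add_left (a := 0) (b := (r : ℝ)) F (t : ℝ)
    rw [add_zero] at h2
    rw [← h2]
    refine intervalIntegral.integral_congr fun σ hσ => ?_
    rw [Set.uIcc_of_le r.coe_nonneg] at hσ
    simp only [hF]
    rw [Real.toNNReal_add t.coe_nonneg hσ.1, Real.toNNReal_coe, S.op_add]
    rfl
  rw [h1, ← intervalIntegral.integral_interval_sub_left (hFi 0 (t + r)) (hFi 0 t), zero_add,
    intervalIntegral.integral_same, add_comm (t : ℝ) r]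
  abel

/-- A bounded generator forces `‖S(r) x - x‖ = O(r)`, uniformly on the unit ball. -/
theorem C0Semigroup.exists_norm_sub_le [CompleteSpace X] (S : C0Semigroup X) {M C : ℝ}
    (hM : ∀ t, ‖S.op t‖ ≤ M)
    (hC : ∀ x : (generator S.op).domain, ‖generator S.op x‖ ≤ C * ‖(x : X)‖) :
    ∃ L : ℝ, 0 ≤ L ∧ ∀ (r : ℝ≥0) (x : X), ‖S.op r x - x‖ ≤ L * r * ‖x‖ := by
  have hM0 : 0 ≤ M := (norm_nonneg _).trans (hM 0)
  refine ⟨|C| * M, by positivity, fun r x => ?_⟩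
  have h1 := S.tendsto_integral_orbit hM x r
  have hd : (∫ σ in (0 : ℝ)..r, S.op σ.toNNReal x) ∈ (generator S.op).domain := ⟨_, h1⟩
  have h2 := hC ⟨_, hd⟩
  rw [generator_apply_eq h1 hd] at h2
  refine h2.trans ((mul_le_mul_of_nonneg_right (le_abs_self C) (norm_nonneg _)).trans ?_)
  have h3 : ‖∫ σ in (0 : ℝ)..r, S.op σ.toNNReal x‖ ≤ M * ‖x‖ * |(r : ℝ) - 0| :=
    intervalIntegral.norm_integral_le_of_norm_le_const fun σ _ =>
      (S.op _).le_of_opNorm_le (hM _) x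
  rw [sub_zero, abs_of_nonneg r.coe_nonneg] at h3
  calc |C| * ‖∫ σ in (0 : ℝ)..r, S.op σ.toNNReal x‖ ≤ |C| * (M * ‖x‖ * r) := by gcongr
    _ = |C| * M * r * ‖x‖ := by ring

end Subordination

/-! ### Boundedness of `ψ` from boundedness of `ψ(∂)` -/

section ClassC

variable {X : Type*} [NormedAddCommGroup X] [NormedSpace ℂ X] {n : ℕ}
  {ev : X →ₗ[ℂ] ((Fin n → ℝ) → ℂ)}

/-- Convergence along a subsequence suffices for continuity, since it may be applied to every
subsequence. -/
theorem IsClassC.continuous_eval_zero (h : IsClassC ev) : Continuous fun x => ev x 0 := by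
  have h0 : Tendsto (fun x => ev x 0) (𝓝 0) (𝓝 0) := by
    refine tendsto_of_seq_tendsto fun x hx => tendsto_of_subseq_tendsto fun ns hns => ?_
    obtain ⟨m, -, hm⟩ := h.eval_zero (fun k => x (ns k)) (hx.comp hns)
    exact ⟨m, hm⟩
  let e : X →+ ℂ := ((LinearMap.proj (0 : Fin n → ℝ)).comp ev : X →ₗ[ℂ] ℂ).toAddMonoidHom
  refine continuous_of_continuousAt_zero e ?_
  rw [ContinuousAt, map_zero]
  exact h0

/-- Test functions with values in the unit disc and support in a common compact set are bounded
in norm. -/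
theorem IsClassC.exists_norm_le (h : IsClassC ev) {Q : Set (Fin n → ℝ)} (hQ : IsCompact Q) :
    ∃ B : ℝ, 0 ≤ B ∧ ∀ x, IsTestFunction (ev x) → tsupport (ev x) ⊆ Q → (∀ s, ‖ev x s‖ ≤ 1) →
      ‖x‖ ≤ B := by
  -- Otherwise there are such `x_k` of norm over `k + 1`, and `x_k / (k + 1) → 0` uniformly.
  by_contra! hcon
  choose x hx1 hx2 hx3 hx4 using fun k : ℕ => hcon ((k : ℝ) + 1) (by positivity)
  set z : ℕ → X := fun k => ((1 / ((k : ℝ) + 1) : ℝ) : ℂ) • x k with hz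
  have hev : ∀ k, ev (z k) = ((1 / ((k : ℝ) + 1) : ℝ) : ℂ) • ev (x k) := fun k => map_smul _ _ _
  have hn : ∀ k : ℕ, ‖((1 / ((k : ℝ) + 1) : ℝ) : ℂ)‖ = 1 / ((k : ℝ) + 1) := fun k => by
    rw [Complex.norm_real, Real.norm_of_nonneg (by positivity)]
  have hsub : ∀ k, tsupport (ev (z k)) ⊆ tsupport (ev (x k)) := fun k => by
    rw [hev]
    exact closure_mono (Function.support_const_smul_subset _ _)
  have hlim : Tendsto z atTop (𝓝 0) := by
    refine h.tendsto_of_uniform z Q hQ (fun k => ⟨?_, ?_⟩)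
      (fun k => (hsub k).trans (hx2 k)) ?_
    · rw [hev]
      exact contDiff_const.smul (hx1 k).1
    · exact (hx1 k).2.of_isClosed_subset (isClosed_tsupport _) (hsub k)
    · rw [Metric.tendstoUniformly_iff]
      intro ε hε
      filter_upwards [(tendsto_one_div_add_atTop_nhds_zero_nat (𝕜 := ℝ)).eventually_lt_const hε]
        with k hk s
      rw [Pi.zero_apply, dist_zero_left, hev, Pi.smul_apply, norm_smul, hn]
      refine lt_of_le_of_lt ?_ hk
      exact mul_le_of_le_one_right (by positivity) (hx3 k s)
  have h1 : ∀ᶠ k in atTop, ‖z k‖ < 1 := by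
    have := hlim.norm
    rw [norm_zero] at this
    exact this.eventually_lt_const one_pos
  obtain ⟨k, hk⟩ := h1.exists
  rw [hz, norm_smul, hn, one_div, inv_mul_lt_iff₀ (by positivity), mul_one] at hk
  exact lt_asymm hk (hx4 k)

/-- A bump function supported in the ball of radius `ε`, as an element of the space. -/
theorem IsClassC.exists_bump (h : IsClassC ev) {ε : ℝ} (hε : 0 < ε) :
    ∃ (x : X) (β : (Fin n → ℝ) → ℝ), ev x = (fun s => (β s : ℂ)) ∧ IsTestFunction (ev x) ∧
      tsupport (ev x) ⊆ Metric.closedBall 0 ε ∧ β 0 = 1 ∧ (∀ s, 0 ≤ β s) ∧ (∀ s, β s ≤ 1) ∧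
      ∀ s, ε ≤ dist s 0 → β s = 0 := by
  let β : ContDiffBump (0 : Fin n → ℝ) := ⟨ε / 2, ε, half_pos hε, half_lt_self hε⟩
  have hts : tsupport (fun s => (β s : ℂ)) ⊆ Metric.closedBall 0 ε := by
    rw [← show tsupport β = Metric.closedBall 0 ε from β.tsupport_eq]
    refine closure_mono fun s hs => ?_
    simpa using hs
  have htest : IsTestFunction fun s => (β s : ℂ) :=
    ⟨Complex.ofRealCLM.contDiff.comp β.contDiff,
      (isCompact_closedBall _ _).of_isClosed_subset (isClosed_tsupport _) hts⟩
  obtain ⟨x, hx⟩ := h.test_mem _ htest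
  refine ⟨x, β, hx, hx ▸ htest, hx ▸ hts, ?_, fun s => β.nonneg, fun s => β.le_one, fun s hs =>
    β.zero_of_le_dist hs⟩
  exact β.one_of_mem_closedBall (Metric.mem_closedBall_self (half_pos hε).le)

/-- If `ψ(∂)` is bounded then `‖g_t - 1‖ = O(t)`. Testing this on bump functions concentrated at
the origin gives `exp (t ψ(s)) ≥ 1 - O(t)` uniformly in `s`, hence a lower bound for `ψ`. -/
theorem IsClassC.boundedOnNegOrthant (h : IsClassC ev) {ψ : (Fin n → ℝ) → ℝ}
    (hψ : IsBernstein ψ) (T : MultiSemigroup n X) (hT : IsTranslation ev T)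
    (hbdd : ∃ C : ℝ, ∀ x : (T.bochnerPhillips ψ).domain,
      ‖T.bochnerPhillips ψ x‖ ≤ C * ‖(x : X)‖) :
    BoundedOnNegOrthant ψ := by
  have := h.complete
  obtain ⟨C, hC⟩ := hbdd
  obtain ⟨M, hM⟩ := T.exists_norm_subordinate_le hψ
  obtain ⟨L, hL0, hL⟩ := (T.subordinateSemigroup hψ).exists_norm_sub_le hM hC
  obtain ⟨B, hB0, hB⟩ := h.exists_norm_le (isCompact_closedBall (0 : Fin n → ℝ) 1)
  let e : X →L[ℂ] ℂ := ⟨(LinearMap.proj (0 : Fin n → ℝ)).comp ev, h.continuous_eval_zero⟩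
  have he : ∀ x, e x = ev x 0 := fun _ => rfl
  set c := ‖e‖ * (L * B) with hc
  have key : ∀ s ∈ negOrthant n, ∀ t : ℝ≥0, 1 - c * t ≤ Real.exp (t * ψ s) := by
    intro s hs t
    set ν := (subMeasure ψ t : Measure (Fin n → ℝ≥0))
    have hker : Integrable (fun u : Fin n → ℝ≥0 => Real.exp (∑ j, s j * (u j : ℝ))) ν :=
      (laplaceKernel s fun j => (hs j).le).integrable _
    refine le_of_forall_pos_le_add fun η hη => ?_
    -- On a small ball the kernel exceeds `1 - η`, so it dominates bumps supported there up to `η`.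
    have hcont : ContinuousAt (fun r : Fin n → ℝ => Real.exp (∑ j, s j * r j)) 0 :=
      (by fun_prop : Continuous fun r : Fin n → ℝ => Real.exp (∑ j, s j * r j)).continuousAt
    obtain ⟨δ, hδ, hδs⟩ := Metric.continuousAt_iff.1 hcont η hη
    obtain ⟨x, β, hx, hxt, hxs, hβ1, hβ0, hβle, hβsupp⟩ :=
      h.exists_bump (lt_min hδ one_pos)
    have hxB : ‖x‖ ≤ B := by
      refine hB x hxt (hxs.trans (Metric.closedBall_subset_closedBall (min_le_right _ _)))
        fun r => ?_
      rw [hx, Complex.norm_real, Real.norm_of_nonneg (hβ0 r)]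
      exact hβle r
    have hpt : ∀ u : Fin n → ℝ≥0,
        β (fun j => (u j : ℝ)) ≤ Real.exp (∑ j, s j * (u j : ℝ)) + η := by
      intro u
      by_cases hu : dist (fun j => (u j : ℝ)) (0 : Fin n → ℝ) < δ
      · have h1 := hδs hu
        simp only [Pi.zero_apply, mul_zero, Finset.sum_const_zero, Real.exp_zero,
          Real.dist_eq] at h1
        have h2 := (abs_lt.1 h1).1
        have h3 := hβle fun j => (u j : ℝ)
        linarith
      · rw [hβsupp _ ((min_le_left _ _).trans (not_lt.1 hu))]
        positivity
    have hint : e (T.subordinate ψ t x) = ((∫ u, β (fun j => (u j : ℝ)) ∂ν : ℝ) : ℂ) := by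
      rw [MultiSemigroup.subordinate, T.integralOp_apply,
        ← ContinuousLinearMap.integral_comp_comm e (T.integrable_op _ x), ← integral_complex_ofReal]
      refine integral_congr_ae (Eventually.of_forall fun u => ?_)
      simp only [he, hT u x 0, hx, Pi.zero_apply, add_zero]
    have hβint : Integrable (fun u : Fin n → ℝ≥0 => β fun j => (u j : ℝ)) ν := by
      have h1 := (e.integrable_comp (T.integrable_op (subMeasure ψ t) x)).re
      refine h1.congr (Eventually.of_forall fun u => ?_)
      simp only [he, hT u x 0, hx, Pi.zero_apply, add_zero]
      rfl
    have h1 : |∫ u, β (fun j => (u j : ℝ)) ∂ν - 1| ≤ c * t := by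
      have hx0 : ev x 0 = 1 := by simp [hx, hβ1]
      have h2 : e (T.subordinate ψ t x - x) =
          ((∫ u, β (fun j => (u j : ℝ)) ∂ν - 1 : ℝ) : ℂ) := by
        rw [map_sub, hint, he x, hx0, Complex.ofReal_sub, Complex.ofReal_one]
      rw [← Real.norm_eq_abs, ← Complex.norm_real, ← h2]
      refine (e.le_opNorm _).trans ?_
      calc ‖e‖ * ‖T.subordinate ψ t x - x‖ ≤ ‖e‖ * (L * t * B) := by
            gcongr
            exact (hL t x).trans (by gcongr)
        _ = c * t := by
            rw [hc]
            ring
    have h2 : ∫ u, β (fun j => (u j : ℝ)) ∂ν ≤ Real.exp (t * ψ s) + η := by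
      refine (integral_mono hβint (hker.add (integrable_const η)) hpt).trans ?_
      rw [integral_add' hker (integrable_const η), hψ.hasLaplaceTransform_subMeasure t s hs,
        integral_const, smul_eq_mul]
      have h3 : ν.real Set.univ ≤ 1 := hψ.mass_subMeasure_le t
      have h4 := mul_le_of_le_one_left hη.le h3
      exact add_le_add le_rfl h4
    have h3 := (abs_le.1 h1).1
    linarith
  refine ⟨c, fun s hs => abs_le.2 ⟨?_, (hψ.nonpos s hs).trans (by positivity)⟩⟩
  -- Divide `1 - c t ≤ exp (t ψ(s))` by `t` and let `t → 0`.
  refine ge_of_tendsto (tendsto_inv_mul_exp_sub_one (ψ s)) ?_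
  filter_upwards [self_mem_nhdsWithin] with t ht
  have ht' : (0 : ℝ) < t := NNReal.coe_pos.2 ht
  rw [← div_eq_inv_mul, le_div_iff₀ ht']
  have := key s hs t
  linarith

end ClassC

/-! ### Spaces of uniformly continuous functions with the sup-norm -/

section SupNorm

variable {X : Type*} [NormedAddCommGroup X] [NormedSpace ℂ X] {n : ℕ}

/-- The elements of `X` are, through `ev`, uniformly continuous functions on `ℝ^n`, normed by the
sup-norm, and `X` is invariant under translations. -/
structure IsSupNormSpace (ev : X →ₗ[ℂ] ((Fin n → ℝ) → ℂ)) : Prop where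
  norm_apply_le : ∀ x s, ‖ev x s‖ ≤ ‖x‖
  norm_le : ∀ x C, 0 ≤ C → (∀ s, ‖ev x s‖ ≤ C) → ‖x‖ ≤ C
  uniformContinuous : ∀ x, UniformContinuous (ev x)
  exists_translate : ∀ (a : Fin n → ℝ) x, ∃ y, ∀ s, ev y s = ev x (a + s)

namespace IsSupNormSpace

variable {ev : X →ₗ[ℂ] ((Fin n → ℝ) → ℂ)} (h : IsSupNormSpace ev)

theorem injective {ev : X →ₗ[ℂ] ((Fin n → ℝ) → ℂ)} (h : IsSupNormSpace ev) :
    Function.Injective ev := by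
  refine (injective_iff_map_eq_zero ev).2 fun x hx => norm_le_zero_iff.1 ?_
  exact h.norm_le x 0 le_rfl fun s => by simp [hx]

/-- The translation `x ↦ x(a + ·)` as a bounded operator. The chosen elements depend linearly on
`x` because `ev` is injective. -/
def translate (a : Fin n → ℝ) : X →L[ℂ] X :=
  LinearMap.mkContinuous
    { toFun := fun x => (h.exists_translate a x).choose
      map_add' := fun x y => h.injective <| funext fun s => by
        refine ((h.exists_translate a (x + y)).choose_spec s).trans ?_
        simp only [map_add, Pi.add_apply, (h.exists_translate a x).choose_spec s,
          (h.exists_translate a y).choose_spec s]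
      map_smul' := fun c x => h.injective <| funext fun s => by
        refine ((h.exists_translate a (c • x)).choose_spec s).trans ?_
        simp only [RingHom.id_apply, map_smul, Pi.smul_apply,
          (h.exists_translate a x).choose_spec s] }
    1 fun x => by
      rw [one_mul]
      refine h.norm_le _ _ (norm_nonneg _) fun s => ?_
      exact (congrArg norm ((h.exists_translate a x).choose_spec s)).trans_le
        (h.norm_apply_le x (a + s))

theorem ev_translate (a : Fin n → ℝ) (x : X) (s : Fin n → ℝ) :
    ev (h.translate a x) s = ev x (a + s) :=
  (h.exists_translate a x).choose_spec s

theorem translate_zero : h.translate 0 = 1 := by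
  ext x
  refine h.injective (funext fun s => ?_)
  rw [ev_translate, zero_add]
  rfl

theorem translate_add (a b : Fin n → ℝ) : h.translate (a + b) = h.translate a * h.translate b := by
  ext x
  refine h.injective (funext fun s => ?_)
  rw [ev_translate, mul_apply_eq_comp, ev_translate, ev_translate, add_comm a b, add_assoc]

theorem norm_translate_le (a : Fin n → ℝ) : ‖h.translate a‖ ≤ 1 :=
  LinearMap.mkContinuous_norm_le _ zero_le_one _

theorem tendsto_translate (x : X) : Tendsto (fun a => h.translate a x) (𝓝 0) (𝓝 x) := by
  rw [Metric.tendsto_nhds]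
  intro ε hε
  obtain ⟨δ, hδ, hδx⟩ := Metric.uniformContinuous_iff.1 (h.uniformContinuous x) (ε / 2)
    (half_pos hε)
  filter_upwards [Metric.ball_mem_nhds (0 : Fin n → ℝ) hδ] with a ha
  rw [dist_eq_norm]
  refine (h.norm_le _ (ε / 2) (half_pos hε).le fun s => ?_).trans_lt (half_lt_self hε)
  rw [map_sub, Pi.sub_apply, ev_translate, ← dist_eq_norm]
  refine (hδx ?_).le
  rw [dist_eq_norm, add_sub_cancel_right]
  simpa using ha

/-- The semigroup of translations by vectors of `ℝ_+^n`. -/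
def translationSemigroup : MultiSemigroup n X where
  part j :=
    { op := fun t => h.translate (Pi.single j (t : ℝ))
      op_zero := by rw [NNReal.coe_zero, Pi.single_zero, translate_zero]
      op_add := fun s t => by rw [NNReal.coe_add, Pi.single_add, translate_add]
      tendsto_zero := fun x => by
        refine (h.tendsto_translate x).comp ?_
        have : Continuous fun t : ℝ≥0 => (Pi.single j (t : ℝ) : Fin n → ℝ) :=
          (continuous_single j).comp NNReal.continuous_coe
        exact this.tendsto' 0 0 (by simp) }
  commute i j s t := by
    rw [commute_iff_eq, ← translate_add, ← translate_add, add_comm]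
  bounded j := ⟨1, fun t => h.norm_translate_le _⟩

theorem isTranslation : IsTranslation ev h.translationSemigroup := by
  intro u x s
  have hl : ∀ l : List (Fin n),
      (l.map fun j => (h.translationSemigroup.part j).op (u j)).prod =
        h.translate (l.map fun j => (Pi.single j (u j : ℝ) : Fin n → ℝ)).sum := by
    intro l
    induction l with
    | nil => simp [translate_zero]
    | cons j l ih =>
      rw [List.map_cons, List.prod_cons, ih, List.map_cons, List.sum_cons, translate_add]
      rfl
  rw [MultiSemigroup.op, List.ofFn_eq_map, hl, ← List.ofFn_eq_map, List.sum_ofFn, ev_translate,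
    Finset.univ_sum_single fun j => (u j : ℝ)]
  rfl

theorem isClassC {ev : X →ₗ[ℂ] ((Fin n → ℝ) → ℂ)} (h : IsSupNormSpace ev) [hX : CompleteSpace X]
    (test_mem : ∀ φ, IsTestFunction φ → ∃ x, ev x = φ) :
    IsClassC ev where
  complete := hX
  injective := h.injective
  test_mem := test_mem
  tendsto_of_uniform x K _ _ _ hx := by
    rw [Metric.tendsto_nhds]
    intro ε hε
    filter_upwards [Metric.tendstoUniformly_iff.1 hx (ε / 2) (half_pos hε)] with k hk
    rw [dist_zero_right]
    refine (h.norm_le _ (ε / 2) (half_pos hε).le fun s => ?_).trans_lt (half_lt_self hε)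
    have := hk s
    rw [Pi.zero_apply, dist_zero_left] at this
    exact this.le
  eval_zero x hx := by
    refine ⟨id, strictMono_id, squeeze_zero_norm (fun k => h.norm_apply_le (x k) 0) ?_⟩
    simpa using hx.norm
  translation := ⟨h.translationSemigroup, h.isTranslation⟩

end IsSupNormSpace

theorem isClassC_evC0 (n : ℕ) : IsClassC (evC0 n) := by
  have h : IsSupNormSpace (evC0 n) :=
    { norm_apply_le := fun f s => by
        rw [← ZeroAtInftyContinuousMap.norm_toBCF_eq_norm]
        exact f.toBCF.norm_coe_le_norm s
      norm_le := fun f C hC hf => by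
        rw [← ZeroAtInftyContinuousMap.norm_toBCF_eq_norm]
        exact (BoundedContinuousFunction.norm_le hC).2 hf
      uniformContinuous := fun f => ZeroAtInftyContinuousMap.uniformContinuous f
      exists_translate := fun a f => ⟨⟨⟨fun s => f (a + s), by fun_prop⟩,
        (zero_at_infty f).comp (Homeomorph.addLeft a).isClosedEmbedding.tendsto_cocompact⟩,
        fun _ => rfl⟩ }
  exact h.isClassC fun φ hφ => ⟨⟨⟨φ, hφ.1.continuous⟩, hφ.2.is_zero_at_infty⟩, rfl⟩

/-- Uniform limits of uniformly continuous functions are uniformly continuous. -/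
theorem isClosed_UCB (n : ℕ) : IsClosed (UCB n : Set ((Fin n → ℝ) →ᵇ ℂ)) := by
  refine IsSeqClosed.isClosed fun f g hf hfg => ?_
  exact (BoundedContinuousFunction.tendsto_iff_tendstoUniformly.1 hfg).uniformContinuous
    (Frequently.of_forall hf)

theorem isClassC_evUCB (n : ℕ) : IsClassC (evUCB n) := by
  have := (isClosed_UCB n).completeSpace_coe
  have h : IsSupNormSpace (evUCB n) :=
    { norm_apply_le := fun f s => f.1.norm_coe_le_norm s
      norm_le := fun f C hC hf => (BoundedContinuousFunction.norm_le hC).2 hf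
      uniformContinuous := fun f => f.2
      exists_translate := fun a f => ⟨⟨f.1.compContinuous ⟨fun s => a + s, by fun_prop⟩,
        UniformContinuous.comp f.2 (uniformContinuous_const.add uniformContinuous_id)⟩,
        fun _ => rfl⟩ }
  refine h.isClassC fun φ hφ => ?_
  obtain ⟨C, hC⟩ := hφ.2.exists_bound_of_continuous hφ.1.continuous
  exact ⟨⟨BoundedContinuousFunction.ofNormedAddCommGroup φ hφ.1.continuous C hC,
    hφ.2.uniformContinuous_of_continuous hφ.1.continuous⟩, rfl⟩

end SupNorm

end BochnerPhillips

end

theorem mainTheorem4 (n : ℕ) (ψ : (Fin n → ℝ) → ℝ) (hψ : BochnerPhillips.IsBernstein ψ) :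
    (BochnerPhillips.BoundedOnNegOrthant ψ →
      ∃ C : ℝ → ℝ, ∀ (X : Type u) [NormedAddCommGroup X] [NormedSpace ℂ X] [CompleteSpace X]
        (T : BochnerPhillips.MultiSemigroup n X) (M : ℝ), 1 ≤ M →
        (∀ j t, ‖(T.part j).op t‖ ≤ M) →
          (T.bochnerPhillips ψ).domain = ⊤ ∧
          ∀ x : (T.bochnerPhillips ψ).domain, ‖T.bochnerPhillips ψ x‖ ≤ C M * ‖(x : X)‖) ∧
    (∀ (X : Type v) [NormedAddCommGroup X] [NormedSpace ℂ X]
        (ev : X →ₗ[ℂ] ((Fin n → ℝ) → ℂ)), BochnerPhillips.IsClassC ev →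
        ∀ T : BochnerPhillips.MultiSemigroup n X, BochnerPhillips.IsTranslation ev T →
          (∃ C : ℝ, ∀ x : (T.bochnerPhillips ψ).domain,
            ‖T.bochnerPhillips ψ x‖ ≤ C * ‖(x : X)‖) →
          BochnerPhillips.BoundedOnNegOrthant ψ) ∧
    (BochnerPhillips.IsClassC (BochnerPhillips.evC0 n) ∧
      BochnerPhillips.IsClassC (BochnerPhillips.evUCB n)) := by
  exact ⟨BochnerPhillips.exists_bochnerPhillips_bound hψ,
    fun X _ _ ev h T hT hbdd => h.boundedOnNegOrthant hψ T hT hbdd,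
    BochnerPhillips.isClassC_evC0 n, BochnerPhillips.isClassC_evUCB n⟩
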